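/- \textbf{Theorem (long-time asymptotics of the normalized constant $h_n$).} For $\alpha>-1$ and $t\ge 0$ let $w(x;t,\alpha)=x^{\alpha}e^{-x-t/x}$, $x>0$, be the singularly perturbed Laguerre weight, let $P_n(x;t,\alpha)$, $n=0,1,2,\ldots$, be the monic polynomials of degree $n$ that are orthogonal with respect to it, i.e. $\int_0^\infty P_j(x;t,\alpha)P_k(x;t,\alpha)\,w(x;t,\alpha)\,dx=0$ for $j\ne k$, and let $$h_n(t)=\int_0^\infty P_n(x;t,\alpha)^2\,w(x;t,\alpha)\,dx>0 .$$ Then, for every fixed $\alpha>-1$ and every fixed integer $n\ge 0$, as $t\to+\infty$, $$\ln h_n(t)=-2\sqrt t+\frac{2\alpha+2n+1}{4}\ln t+\widehat C(n)+\frac{(2\alpha+2n+1)(2\alpha+6n+3)}{16\sqrt t}+O(t^{-1}),$$ where $$\widehat C(n)=\frac{\ln\pi}{2}-n\ln 2+\ln\Gamma(n+1)$$ and $\Gamma$ is the gamma function. The constant implied by $O(t^{-1})$ may depend on $\alpha$ and $n$. -/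

import Mathlib

open Polynomial Set MeasureTheory Filter Asymptotics

namespace SingularLaguerre

/-- The singularly perturbed Laguerre weight `w(x; t, α) = x ^ α * exp (-x - t / x)`; it is used
for `x > 0` only. -/
noncomputable def weight (t α x : ℝ) : ℝ :=
  x ^ α * Real.exp (-x - t / x)

/-- The pairing `∫₀^∞ p(x) q(x) w(x; t, α) dx` of two real polynomials. -/
noncomputable def pairing (t α : ℝ) (p q : ℝ[X]) : ℝ :=
  ∫ x in Ioi (0 : ℝ), p.eval x * q.eval x * weight t α x

/-- The monic orthogonal polynomials `P_n(x; t, α)`, obtained from `1, X, X ^ 2, …` by the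
Gram-Schmidt process without normalization. They are characterized by `orthPoly_monic`,
`natDegree_orthPoly` and `pairing_orthPoly` below. -/
noncomputable def orthPoly (t α : ℝ) (n : ℕ) : ℝ[X] :=
  X ^ n - ∑ k : Fin n,
    C (pairing t α (X ^ n) (orthPoly t α k) / pairing t α (orthPoly t α k) (orthPoly t α k))
      * orthPoly t α k
termination_by n
decreasing_by all_goals exact k.2

/-- The normalized constant `h_n(t, α) = ∫₀^∞ P_n(x; t, α) ^ 2 w(x; t, α) dx`. -/
noncomputable def normConst (t α : ℝ) (n : ℕ) : ℝ :=
  ∫ x in Ioi (0 : ℝ), (orthPoly t α n).eval x ^ 2 * weight t α x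

/-! Checks that `orthPoly` and `normConst` are the intended objects for `α > -1`, `t ≥ 0`. -/

theorem weight_pos {t α x : ℝ} (hx : 0 < x) : 0 < weight t α x :=
  mul_pos (Real.rpow_pos_of_pos hx _) (Real.exp_pos _)

theorem integrableOn_pow_mul_weight {t α : ℝ} (hα : -1 < α) (ht : 0 ≤ t) (j : ℕ) :
    IntegrableOn (fun x : ℝ => x ^ j * weight t α x) (Ioi 0) := by
  have hs : 0 < α + j + 1 := by
    have : (0 : ℝ) ≤ j := j.cast_nonneg
    linarith
  have h := Real.GammaIntegral_convergent hs
  refine Integrable.mono' h ?_ ?_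
  · have : Measurable (fun x : ℝ => x ^ j * weight t α x) := by
      unfold weight
      fun_prop
    exact this.aestronglyMeasurable
  · filter_upwards [ae_restrict_mem measurableSet_Ioi] with x hx
    have hx' : (0 : ℝ) < x := hx
    have h1 : 0 ≤ x ^ j * weight t α x := mul_nonneg (pow_nonneg hx'.le _) (weight_pos hx').le
    rw [Real.norm_of_nonneg h1]
    have h2 : x ^ (α + j + 1 - 1) = x ^ j * x ^ α := by
      rw [add_sub_cancel_right, Real.rpow_add hx', Real.rpow_natCast, mul_comm]
    rw [h2, weight, ← mul_assoc, mul_comm (Real.exp (-x))]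
    have h3 : 0 ≤ t / x := div_nonneg ht hx'.le
    gcongr
    linarith

theorem integrableOn_eval_mul_weight {t α : ℝ} (hα : -1 < α) (ht : 0 ≤ t) (p : ℝ[X]) :
    IntegrableOn (fun x : ℝ => p.eval x * weight t α x) (Ioi 0) := by
  induction p using Polynomial.induction_on' with
  | add p q hp hq =>
    refine (hp.add hq).congr (Eventually.of_forall fun x => ?_)
    simp [add_mul]
  | monomial n a =>
    refine ((integrableOn_pow_mul_weight hα ht n).const_mul a).congr
      (Eventually.of_forall fun x => ?_)
    simp [mul_assoc]

theorem integrableOn_pairing {t α : ℝ} (hα : -1 < α) (ht : 0 ≤ t) (p q : ℝ[X]) :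
    IntegrableOn (fun x : ℝ => p.eval x * q.eval x * weight t α x) (Ioi 0) := by
  simpa using integrableOn_eval_mul_weight hα ht (p * q)

theorem pairing_comm (t α : ℝ) (p q : ℝ[X]) : pairing t α p q = pairing t α q p := by
  simp only [pairing, mul_comm]

theorem pairing_self_pos {t α : ℝ} (hα : -1 < α) (ht : 0 ≤ t) {p : ℝ[X]} (hp : p ≠ 0) :
    0 < pairing t α p p := by
  unfold pairing
  rw [setIntegral_pos_iff_support_of_nonneg_ae _ (integrableOn_pairing hα ht p p)]
  · have hsub : Ioi (0 : ℝ) \ (p.roots.toFinset : Set ℝ) ⊆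
        Function.support (fun x : ℝ => p.eval x * p.eval x * weight t α x) ∩ Ioi 0 := by
      rintro x ⟨hx, hr⟩
      refine ⟨?_, hx⟩
      have h0 : p.eval x ≠ 0 := by
        intro h
        apply hr
        simp [hp, h]
      exact mul_ne_zero (mul_ne_zero h0 h0) (weight_pos hx).ne'
    refine lt_of_lt_of_le ?_ (measure_mono hsub)
    rw [measure_sdiff_null ((p.roots.toFinset.finite_toSet).measure_zero _)]
    simp
  · filter_upwards [ae_restrict_mem measurableSet_Ioi] with x hx
    exact mul_nonneg (mul_self_nonneg _) (weight_pos hx).le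

theorem pairing_sub_sum {t α : ℝ} (hα : -1 < α) (ht : 0 ≤ t) {n : ℕ} (p q : ℝ[X])
    (c : Fin n → ℝ) (P : Fin n → ℝ[X]) :
    pairing t α (p - ∑ k, C (c k) * P k) q =
      pairing t α p q - ∑ k, c k * pairing t α (P k) q := by
  unfold pairing
  simp_rw [← integral_const_mul]
  rw [← integral_finsetSum _ fun k _ => (integrableOn_pairing hα ht (P k) q).const_mul (c k),
    ← integral_sub (integrableOn_pairing hα ht p q)
      (integrable_finsetSum _ fun k _ => (integrableOn_pairing hα ht (P k) q).const_mul (c k))]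
  congr 1
  ext x
  simp only [eval_sub, eval_finsetSum, eval_mul, eval_C, sub_mul, Finset.sum_mul, mul_assoc]

theorem orthPoly_monic_and_natDegree (t α : ℝ) (n : ℕ) :
    (orthPoly t α n).Monic ∧ (orthPoly t α n).natDegree = n := by
  induction n using Nat.strong_induction_on with
  | _ n ih =>
    have hlt : (∑ k : Fin n, C (pairing t α (X ^ n) (orthPoly t α k) /
        pairing t α (orthPoly t α k) (orthPoly t α k)) * orthPoly t α k).degree
        < (n : WithBot ℕ) := by
      refine (degree_sum_le _ _).trans_lt ?_
      refine (Finset.sup_lt_iff (WithBot.bot_lt_coe n)).2 ?_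
      intro k _
      refine degree_le_natDegree.trans_lt ?_
      have h := (natDegree_C_mul_le (pairing t α (X ^ n) (orthPoly t α k) /
        pairing t α (orthPoly t α k) (orthPoly t α k)) (orthPoly t α k)).trans_lt
        ((ih k k.2).2.trans_lt k.2)
      exact WithBot.coe_lt_coe.2 h
    rw [orthPoly]
    have hX := degree_X_pow (R := ℝ) n
    rw [← hX] at hlt
    refine ⟨(monic_X_pow (R := ℝ) n).sub_of_left hlt, ?_⟩
    rw [natDegree_eq_of_degree_eq (degree_sub_eq_left_of_degree_lt hlt), natDegree_X_pow]

/-- `P_n` is monic. -/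
theorem orthPoly_monic (t α : ℝ) (n : ℕ) : (orthPoly t α n).Monic :=
  (orthPoly_monic_and_natDegree t α n).1

/-- `P_n` has degree `n`. -/
theorem natDegree_orthPoly (t α : ℝ) (n : ℕ) : (orthPoly t α n).natDegree = n :=
  (orthPoly_monic_and_natDegree t α n).2

theorem normConst_eq_pairing (t α : ℝ) (n : ℕ) :
    normConst t α n = pairing t α (orthPoly t α n) (orthPoly t α n) := by
  simp only [normConst, pairing, sq]

/-- `h_n > 0`. -/
theorem normConst_pos {t α : ℝ} (hα : -1 < α) (ht : 0 ≤ t) (n : ℕ) : 0 < normConst t α n := by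
  rw [normConst_eq_pairing]
  exact pairing_self_pos hα ht (orthPoly_monic t α n).ne_zero

theorem pairing_orthPoly_of_lt {t α : ℝ} (hα : -1 < α) (ht : 0 ≤ t) (n : ℕ) :
    ∀ j < n, pairing t α (orthPoly t α n) (orthPoly t α j) = 0 := by
  induction n using Nat.strong_induction_on with
  | _ n ih =>
    intro j hj
    rw [orthPoly, pairing_sub_sum hα ht, Finset.sum_eq_single (⟨j, hj⟩ : Fin n)]
    · have h := (pairing_self_pos hα ht (orthPoly_monic t α j).ne_zero).ne'
      dsimp only
      rw [div_mul_cancel₀ _ h, sub_self]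
    · intro k _ hk
      have hne : (k : ℕ) ≠ j := fun h => hk (Fin.ext h)
      rcases lt_or_gt_of_ne hne with h | h
      · rw [pairing_comm t α (orthPoly t α k) (orthPoly t α j), ih j hj k h, mul_zero]
      · rw [ih k k.2 j h, mul_zero]
    · intro h
      exact absurd (Finset.mem_univ _) h

/-- The orthogonality relation `∫₀^∞ P_j P_k w dx = h_j δ_{jk}`. -/
theorem pairing_orthPoly {t α : ℝ} (hα : -1 < α) (ht : 0 ≤ t) (j k : ℕ) :
    pairing t α (orthPoly t α j) (orthPoly t α k) = if j = k then normConst t α j else 0 := by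
  split_ifs with h
  · rw [← h, normConst_eq_pairing]
  · rcases lt_or_gt_of_ne h with h | h
    · rw [pairing_comm, pairing_orthPoly_of_lt hα ht k j h]
    · exact pairing_orthPoly_of_lt hα ht j k h

end SingularLaguerre

/-! Put t = s². The substitution x = s * exp u turns the zeroth moment into an explicit prefactor
times the integral of exp ((α + 1) u - s * zsq u), a modified Bessel function, and its expansion
through order 1 / s gives the case n = 0 (`exists_bessel_asymptotics`).

Higher n follow from h_n = h_0 b_1 ⋯ b_n, where a_n, b_n are the three-term recurrence coefficients.
Integrating the derivative of x² f w for f = P_n² and f = P_(n+1) P_n gives two nonlinear equations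
between them (`string_one`, `string_two`). With y_n = a_n / s and c_n = b_n / s, balancing the
leading terms suggests y_n → 1 and c_n → n / 2.

To make this rigorous, a priori bounds are needed. Since the weight concentrates at x = s, testing
the minimum property of P_n on (X - s)^n bounds h_n / (h_0 s^n), that is, the product c_1 ⋯ c_n. An
induction through the string equations then bounds each c_n and each s (y_n - 1)
(`StringSystem.bounds`). Once everything is bounded, the same equations, solved for c_n and s (y_n -
1), give their limits, and a second pass gives the 1 / s term of c_n
(`StringSystem.c_succ_asymptotics`). Taking logarithms and summing proves the theorem. -/

namespace SingularLaguerre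

/-! ### Monic orthogonal polynomials of a functional: recurrence and string equations. -/

/-- `P` is the sequence of monic orthogonal polynomials of the linear functional `L`, with squared
norms `h`. -/
structure IsMonicOrth (L : ℝ[X] →ₗ[ℝ] ℝ) (P : ℕ → ℝ[X]) (h : ℕ → ℝ) : Prop where
  monic : ∀ n, (P n).Monic
  natDegree : ∀ n, (P n).natDegree = n
  orth : ∀ n k, k < n → L (P n * P k) = 0
  norm : ∀ n, L (P n * P n) = h n
  norm_ne : ∀ n, h n ≠ 0
  definite : ∀ p, L (p * p) = 0 → p = 0

namespace IsMonicOrth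

variable {L : ℝ[X] →ₗ[ℝ] ℝ} {P : ℕ → ℝ[X]} {h : ℕ → ℝ}

theorem degree_eq (H : IsMonicOrth L P h) (n : ℕ) : (P n).degree = n := by
  rw [degree_eq_natDegree (H.monic n).ne_zero, H.natDegree]

theorem P_zero (H : IsMonicOrth L P h) : P 0 = 1 :=
  (H.monic 0).natDegree_eq_zero.1 (H.natDegree 0)

theorem map_mul_of_degree_lt (H : IsMonicOrth L P h) (n : ℕ) (q : ℝ[X]) (hq : q.degree < n) :
    L (P n * q) = 0 := by
  -- The degree bound m is separated from n so that leading terms of q can be stripped off while P n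
  -- stays fixed.
  suffices h : ∀ m ≤ n, ∀ q : ℝ[X], q.degree < m → L (P n * q) = 0 from h n le_rfl q hq
  intro m
  induction m with
  | zero =>
    intro _ q hq
    have : q = 0 := by
      rw [← degree_eq_bot]
      by_contra h0
      rw [degree_eq_natDegree (by rintro rfl; simp at h0)] at hq
      exact absurd (WithBot.coe_lt_coe.1 hq) (by simp)
    simp [this]
  | succ m ih =>
    intro hm q hq
    have hq' : q.degree ≤ m := by
      rw [degree_lt_iff_coeff_zero] at hq
      rw [degree_le_iff_coeff_zero]
      intro k hk
      exact hq k (WithBot.coe_lt_coe.1 hk)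
    have h1 : (q - C (q.coeff m) * P m).degree < m := by
      rw [degree_lt_iff_coeff_zero]
      intro k hk
      rcases hk.eq_or_lt with rfl | hk
      · have := (H.monic m).coeff_natDegree
        rw [H.natDegree] at this
        simp [this]
      · rw [degree_le_iff_coeff_zero] at hq'
        have h2 : (P m).coeff k = 0 := coeff_eq_zero_of_natDegree_lt (by rw [H.natDegree]; exact hk)
        simp [h2, hq' k (by exact_mod_cast hk)]
    have h2 := ih (by omega) _ h1
    rw [mul_sub, map_sub, sub_eq_zero] at h2
    rw [h2, mul_left_comm, C_mul', map_smul, H.orth n m (by omega), smul_zero]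

theorem map_mul_of_degree_le (H : IsMonicOrth L P h) (n : ℕ) (q : ℝ[X]) (hq : q.degree ≤ n) :
    L (P n * q) = q.coeff n * h n := by
  have h1 : (q - C (q.coeff n) * P n).degree < n := by
    rw [degree_le_iff_coeff_zero] at hq
    rw [degree_lt_iff_coeff_zero]
    intro k hk
    rcases hk.eq_or_lt with rfl | hk
    · have := (H.monic n).coeff_natDegree
      rw [H.natDegree] at this
      simp [this]
    · have h2 : (P n).coeff k = 0 := coeff_eq_zero_of_natDegree_lt (by rw [H.natDegree]; exact hk)
      simp [h2, hq k (by exact_mod_cast hk)]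
  have h2 := H.map_mul_of_degree_lt n _ h1
  rw [mul_sub, map_sub, sub_eq_zero] at h2
  rw [h2, mul_left_comm, C_mul', map_smul, H.norm, smul_eq_mul]

theorem map_mul_eq_zero (H : IsMonicOrth L P h) {n k : ℕ} (hk : n ≠ k) : L (P n * P k) = 0 := by
  rcases lt_or_gt_of_ne hk with h1 | h1
  · rw [mul_comm]; exact H.orth k n h1
  · exact H.orth n k h1

/-- The minimum property of the monic orthogonal polynomials. -/
theorem map_sq_eq (H : IsMonicOrth L P h) (n : ℕ) (q : ℝ[X]) (hq : q.Monic)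
    (hd : q.natDegree = n) : L (q * q) = h n + L ((q - P n) * (q - P n)) := by
  have h1 : (q - P n).degree < n := by
    have := degree_sub_lt_left (p := q) (q := P n)
      (by rw [H.degree_eq, degree_eq_natDegree hq.ne_zero, hd]) hq.ne_zero
      (by rw [hq.leadingCoeff, (H.monic n).leadingCoeff])
    rwa [degree_eq_natDegree hq.ne_zero, hd] at this
  have h2 := H.map_mul_of_degree_lt n _ h1
  have h3 : q * q = P n * P n + (P n * (q - P n) + P n * (q - P n)) + (q - P n) * (q - P n) := by
    ring
  rw [h3, map_add, map_add, map_add, h2, H.norm]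
  ring

/-- The diagonal recurrence coefficients. -/
noncomputable def a (L : ℝ[X] →ₗ[ℝ] ℝ) (P : ℕ → ℝ[X]) (h : ℕ → ℝ) (n : ℕ) : ℝ :=
  L (X * P n * P n) / h n

/-- The off-diagonal recurrence coefficients. -/
noncomputable def b (h : ℕ → ℝ) : ℕ → ℝ
  | 0 => 0
  | n + 1 => h (n + 1) / h n

theorem map_X_mul_self (H : IsMonicOrth L P h) (n : ℕ) : L (X * P n * P n) = a L P h n * h n := by
  rw [a, div_mul_cancel₀ _ (H.norm_ne n)]

theorem b_succ_mul (H : IsMonicOrth L P h) (n : ℕ) : b h (n + 1) * h n = h (n + 1) := by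
  rw [b, div_mul_cancel₀ _ (H.norm_ne n)]

theorem degree_X_mul (H : IsMonicOrth L P h) (n : ℕ) :
    (X * P n).degree = ((n + 1 : ℕ) : WithBot ℕ) := by
  rw [mul_comm, degree_mul_X, H.degree_eq]; rfl

theorem coeff_X_mul_succ (H : IsMonicOrth L P h) (n : ℕ) : (X * P n).coeff (n + 1) = 1 := by
  have := (H.monic n).coeff_natDegree
  rw [H.natDegree] at this
  rw [coeff_X_mul, this]

theorem map_X_mul_succ (H : IsMonicOrth L P h) (n : ℕ) : L (X * P n * P (n + 1)) = h (n + 1) := by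
  rw [mul_comm, H.map_mul_of_degree_le _ _ (H.degree_X_mul n).le, H.coeff_X_mul_succ, one_mul]

theorem degree_lt_of_recurrence (H : IsMonicOrth L P h) (n : ℕ) (q : ℝ[X])
    (hq : q.degree ≤ n) : (X * P n - P (n + 1) - q).degree < ((n + 1 : ℕ) : WithBot ℕ) := by
  have h1 : (X * P n - P (n + 1)).degree < ((n + 1 : ℕ) : WithBot ℕ) := by
    have hm : (X * P n).Monic := monic_X.mul (H.monic n)
    have := degree_sub_lt_left (p := X * P n) (q := P (n + 1))
      (by rw [H.degree_eq, H.degree_X_mul]) hm.ne_zero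
      (by rw [hm.leadingCoeff, (H.monic _).leadingCoeff])
    rwa [H.degree_X_mul] at this
  refine (degree_sub_le _ _).trans_lt (max_lt h1 (hq.trans_lt ?_))
  exact_mod_cast Nat.lt_succ_self n

/-- Pairing with P n reads off the top coefficient of D times h n ≠ 0, so the coefficients vanish
from the top down. This reduces the recurrence relation to checking pairings with each P k. -/
theorem eq_zero_of_orth (H : IsMonicOrth L P h) (n : ℕ) (D : ℝ[X]) (hD : D.degree < n)
    (ho : ∀ k < n, L (P k * D) = 0) : D = 0 := by
  induction n with
  | zero =>
    rw [← degree_eq_bot]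
    by_contra h0
    rw [degree_eq_natDegree (by rintro rfl; simp at h0)] at hD
    exact absurd (WithBot.coe_lt_coe.1 hD) (by simp)
  | succ n ih =>
    have hD' : D.degree ≤ n := by
      rw [degree_lt_iff_coeff_zero] at hD
      rw [degree_le_iff_coeff_zero]
      intro k hk
      exact hD k (WithBot.coe_lt_coe.1 hk)
    have h1 := H.map_mul_of_degree_le n D hD'
    rw [ho n (Nat.lt_succ_self n)] at h1
    have h2 : D.coeff n = 0 := by
      rcases mul_eq_zero.1 h1.symm with h | h
      · exact h
      · exact absurd h (H.norm_ne n)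
    refine ih ?_ fun k hk => ho k (by omega)
    rw [degree_lt_iff_coeff_zero]
    intro k hk
    rcases hk.eq_or_lt with rfl | hk
    · exact h2
    · exact (degree_lt_iff_coeff_zero _ _).1 hD k hk

/-- The three-term recurrence relation. -/
theorem X_mul_eq (H : IsMonicOrth L P h) (n : ℕ) :
    X * P (n + 1) = P (n + 2) + a L P h (n + 1) • P (n + 1) + b h (n + 1) • P n := by
  have hd : (a L P h (n + 1) • P (n + 1) + b h (n + 1) • P n).degree ≤
      ((n + 1 : ℕ) : WithBot ℕ) := by
    refine (degree_add_le _ _).trans (max_le ((degree_smul_le _ _).trans (H.degree_eq _).le)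
      ((degree_smul_le _ _).trans ?_))
    rw [H.degree_eq]
    exact_mod_cast Nat.le_succ n
  have := H.eq_zero_of_orth _ _ (H.degree_lt_of_recurrence (n + 1) _ hd) ?_
  · rw [sub_sub, sub_eq_zero] at this
    exact this.trans (add_assoc _ _ _).symm
  · intro k hk
    have e : P k * (X * P (n + 1) - P (n + 2) - (a L P h (n + 1) • P (n + 1) + b h (n + 1) • P n))
        = P (n + 1) * (X * P k) - P (n + 2) * P k - (a L P h (n + 1) • (P (n + 1) * P k)
          + b h (n + 1) • (P n * P k)) := by
      simp only [smul_eq_C_mul]; ring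
    rw [e, map_sub, map_sub, map_add, map_smul, map_smul, H.map_mul_eq_zero (by omega), sub_zero]
    rcases lt_trichotomy k n with h1 | rfl | h1
    · rw [H.map_mul_of_degree_lt _ _ (by rw [H.degree_X_mul]; exact_mod_cast (by omega)),
        H.map_mul_eq_zero (by omega), H.map_mul_eq_zero (by omega)]
      simp
    · rw [H.map_mul_of_degree_le _ _ (H.degree_X_mul k).le, H.coeff_X_mul_succ,
        H.map_mul_eq_zero (by omega), H.norm, smul_eq_mul, smul_eq_mul, H.b_succ_mul]
      ring
    · obtain rfl : k = n + 1 := by omega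
      rw [mul_comm, H.map_X_mul_self, H.norm, H.map_mul_eq_zero (by omega), smul_eq_mul]
      simp

theorem X_mul_zero_eq (H : IsMonicOrth L P h) :
    X * P 0 = P 1 + a L P h 0 • P 0 := by
  have hd : (a L P h 0 • P 0).degree ≤ (0 : ℕ) := (degree_smul_le _ _).trans (H.degree_eq _).le
  have := H.eq_zero_of_orth _ _ (H.degree_lt_of_recurrence 0 _ hd) ?_
  · rwa [sub_sub, sub_eq_zero] at this
  · intro k hk
    obtain rfl : k = 0 := by omega
    have e : P 0 * (X * P 0 - P 1 - a L P h 0 • P 0)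
        = X * P 0 * P 0 - P 1 * P 0 - a L P h 0 • (P 0 * P 0) := by
      simp only [smul_eq_C_mul]; ring
    rw [e, map_sub, map_sub, map_smul, H.map_mul_eq_zero (by omega), H.map_X_mul_self, H.norm]
    simp

theorem map_X_mul_pred (H : IsMonicOrth L P h) (n : ℕ) : L (X * P (n + 1) * P n) = h (n + 1) := by
  rw [mul_right_comm, H.map_X_mul_succ]

/-- The three-term recurrence relation, paired with `q`. -/
theorem map_X_mul (H : IsMonicOrth L P h) (n : ℕ) (q : ℝ[X]) :
    L (q * (X * P n)) =
      L (q * P (n + 1)) + a L P h n * L (q * P n) + b h n * L (q * P (n - 1)) := by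
  cases n with
  -- Here the truncated index n - 1 is 0; the spurious term disappears because b h 0 = 0.
  | zero => rw [H.X_mul_zero_eq]; simp [mul_add, b]
  | succ n => rw [H.X_mul_eq]; simp [mul_add]

theorem map_X_sq_mul_self (H : IsMonicOrth L P h) (n : ℕ) :
    L (X * P n * (X * P n)) = (b h (n + 1) + a L P h n ^ 2 + b h n) * h n := by
  rw [H.map_X_mul, H.map_X_mul_succ, H.map_X_mul_self, ← H.b_succ_mul]
  cases n with
  | zero => simp [b]; ring
  | succ n =>
    rw [Nat.add_sub_cancel, H.map_X_mul_pred]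
    ring

theorem map_X_sq_mul_succ (H : IsMonicOrth L P h) (n : ℕ) :
    L (X * P n * (X * P (n + 1))) = (a L P h (n + 1) + a L P h n) * h (n + 1) := by
  rw [H.map_X_mul, H.map_X_mul_succ, Nat.add_sub_cancel, H.map_X_mul_self,
    mul_comm _ (P (n + 2)), H.map_mul_of_degree_lt _ _
      (by rw [H.degree_X_mul]; exact_mod_cast (by omega)), ← H.b_succ_mul]
  ring

theorem degree_X_sq_mul_derivative_le (H : IsMonicOrth L P h) (n : ℕ) :
    (X ^ 2 * derivative (P n)).degree ≤ ((n + 1 : ℕ) : WithBot ℕ) := by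
  rw [degree_le_iff_coeff_zero]
  intro k hk
  have hk : n + 1 < k := by exact_mod_cast hk
  obtain ⟨m, rfl⟩ : ∃ m, k = m + 2 := ⟨k - 2, by omega⟩
  rw [coeff_X_pow_mul, coeff_derivative,
    coeff_eq_zero_of_natDegree_lt (by rw [H.natDegree]; omega), zero_mul]

theorem map_X_sq_mul_derivative_succ (H : IsMonicOrth L P h) (n : ℕ) :
    L (X ^ 2 * derivative (P n) * P (n + 1)) = n * h (n + 1) := by
  rw [mul_comm, H.map_mul_of_degree_le _ _ (H.degree_X_sq_mul_derivative_le n)]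
  cases n with
  | zero =>
    have : P 0 = 1 := H.P_zero
    simp [this]
  | succ n =>
    have := (H.monic (n + 1)).coeff_natDegree
    rw [H.natDegree] at this
    rw [show n + 1 + 1 = n + 2 from rfl, coeff_X_pow_mul, coeff_derivative, this]
    push_cast; ring

theorem map_X_sq_mul_derivative_of_lt (H : IsMonicOrth L P h) {n k : ℕ} (hk : n + 1 < k) :
    L (X ^ 2 * derivative (P n) * P k) = 0 := by
  rw [mul_comm]
  refine H.map_mul_of_degree_lt _ _ ((H.degree_X_sq_mul_derivative_le n).trans_lt ?_)
  exact_mod_cast hk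

theorem P_succ (H : IsMonicOrth L P h) (n : ℕ) :
    P (n + 1) = X * P n - a L P h n • P n - b h n • P (n - 1) := by
  cases n with
  | zero => rw [H.X_mul_zero_eq]; simp [b]
  | succ n => rw [H.X_mul_eq, Nat.add_sub_cancel]; abel

/-- This is the differentiated three-term recurrence. It drives the two inductions below, with X * q
expanded by the recurrence again. -/
theorem map_X_sq_mul_derivative_P_succ (H : IsMonicOrth L P h) (n : ℕ) (q : ℝ[X]) :
    L (X ^ 2 * derivative (P (n + 1)) * q) = L (X * P n * (X * q))
      + L (X ^ 2 * derivative (P n) * (X * q)) - a L P h n * L (X ^ 2 * derivative (P n) * q)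
      - b h n * L (X ^ 2 * derivative (P (n - 1)) * q) := by
  have e : X ^ 2 * derivative (P (n + 1)) * q = X * P n * (X * q)
      + X ^ 2 * derivative (P n) * (X * q) - a L P h n • (X ^ 2 * derivative (P n) * q)
      - b h n • (X ^ 2 * derivative (P (n - 1)) * q) := by
    rw [H.P_succ]
    simp only [derivative_sub, derivative_mul, derivative_X, smul_eq_C_mul, derivative_C]
    ring
  rw [e, map_sub, map_sub, map_add, map_smul, map_smul, smul_eq_mul, smul_eq_mul]

/-- The sum of the a j is minus the subleading coefficient of P n; the induction produces it without
computing that coefficient. -/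
theorem map_X_sq_mul_derivative_self (H : IsMonicOrth L P h) (n : ℕ) :
    L (X ^ 2 * derivative (P n) * P n) =
      (n * a L P h n + ∑ j ∈ Finset.range n, a L P h j) * h n := by
  induction n with
  | zero =>
    have : P 0 = 1 := H.P_zero
    simp [this]
  | succ n ih =>
    rw [H.map_X_sq_mul_derivative_P_succ, H.map_X_sq_mul_succ, H.map_X_mul,
      H.map_X_sq_mul_derivative_succ, H.map_X_sq_mul_derivative_of_lt (by omega),
      Nat.add_sub_cancel, ih, ← H.b_succ_mul, Finset.sum_range_succ]
    have h0 : b h n * L (X ^ 2 * derivative (P (n - 1)) * P (n + 1)) = 0 := by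
      cases n with
      | zero => simp [b]
      | succ n => rw [H.map_X_sq_mul_derivative_of_lt (by simp), mul_zero]
    rw [h0]
    push_cast; ring

/-- In the inductive step the pairing of X² P' with P itself occurs twice, with opposite signs, and
cancels; the squared norm of X * P contributes the new a² and b terms. -/
theorem map_X_sq_mul_derivative_pred (H : IsMonicOrth L P h) (n : ℕ) :
    L (X ^ 2 * derivative (P (n + 1)) * P n) =
      ((n + 1) * b h (n + 1) + ∑ j ∈ Finset.range (n + 1), a L P h j ^ 2
        + 2 * ∑ j ∈ Finset.range (n + 1), b h j) * h n := by
  induction n with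
  | zero =>
    have h1 : P 0 = 1 := H.P_zero
    rw [H.map_X_sq_mul_derivative_P_succ, H.map_X_sq_mul_self]
    simp [b, h1]
  | succ n ih =>
    rw [H.map_X_sq_mul_derivative_P_succ, H.map_X_sq_mul_self, H.map_X_mul,
      H.map_X_sq_mul_derivative_succ, Nat.add_sub_cancel, ih, H.map_X_sq_mul_derivative_succ,
      Finset.sum_range_succ _ (n + 1), Finset.sum_range_succ (b h) (n + 1), ← H.b_succ_mul (n + 1),
      ← H.b_succ_mul n]
    push_cast; ring

variable {t α : ℝ}

/-- The first string equation. -/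
theorem string_one (H : IsMonicOrth L P h)
    (ibp : ∀ f : ℝ[X], L (X ^ 2 * derivative f) + (α + 2) * L (X * f) - L (X ^ 2 * f)
      + t * L f = 0) (n : ℕ) :
    b h (n + 1) + b h n = t + (2 * n + α + 2) * a L P h n
      + 2 * ∑ j ∈ Finset.range n, a L P h j - a L P h n ^ 2 := by
  -- For the Laguerre functional, `ibp` says that the derivative of x² f w integrates to zero. For
  -- this f every resulting pairing has been computed above.
  have h1 := ibp (P n * P n)
  have e : X ^ 2 * derivative (P n * P n) = X ^ 2 * derivative (P n) * P n
      + X ^ 2 * derivative (P n) * P n := by rw [derivative_mul]; ring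
  rw [e, map_add, H.map_X_sq_mul_derivative_self, ← mul_assoc, H.map_X_mul_self,
    show X ^ 2 * (P n * P n) = X * P n * (X * P n) by ring, H.map_X_sq_mul_self, H.norm] at h1
  have h2 := H.norm_ne n
  apply mul_right_cancel₀ h2
  linear_combination -h1

/-- The second string equation. -/
theorem string_two (H : IsMonicOrth L P h)
    (ibp : ∀ f : ℝ[X], L (X ^ 2 * derivative f) + (α + 2) * L (X * f) - L (X ^ 2 * f)
      + t * L f = 0) (n : ℕ) :
    b h (n + 1) * (a L P h (n + 1) + a L P h n - (2 * n + 3 + α)) =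
      ∑ j ∈ Finset.range (n + 1), a L P h j ^ 2 + 2 * ∑ j ∈ Finset.range (n + 1), b h j := by
  have h1 := ibp (P (n + 1) * P n)
  have e : X ^ 2 * derivative (P (n + 1) * P n) = X ^ 2 * derivative (P (n + 1)) * P n
      + X ^ 2 * derivative (P n) * P (n + 1) := by rw [derivative_mul]; ring
  rw [e, map_add, H.map_X_sq_mul_derivative_pred, H.map_X_sq_mul_derivative_succ, ← mul_assoc,
    H.map_X_mul_pred, show X ^ 2 * (P (n + 1) * P n) = X * P n * (X * P (n + 1)) by ring,
    H.map_X_sq_mul_succ, H.orth _ _ (Nat.lt_succ_self n), ← H.b_succ_mul] at h1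
  have h2 := H.norm_ne n
  apply mul_right_cancel₀ h2
  linear_combination -h1

end IsMonicOrth

/-! ### The functional of the weight: positivity and integration by parts. -/

/-- Integration against the weight, as a linear functional on polynomials. -/
noncomputable def functional {t α : ℝ} (hα : -1 < α) (ht : 0 ≤ t) : ℝ[X] →ₗ[ℝ] ℝ where
  toFun p := ∫ x in Ioi (0 : ℝ), p.eval x * weight t α x
  map_add' p q := by
    rw [← integral_add (integrableOn_eval_mul_weight hα ht p)
      (integrableOn_eval_mul_weight hα ht q)]
    simp [add_mul]
  map_smul' c p := by
    rw [RingHom.id_apply, smul_eq_mul, ← integral_const_mul]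
    simp [mul_assoc]

theorem functional_apply {t α : ℝ} (hα : -1 < α) (ht : 0 ≤ t) (p : ℝ[X]) :
    functional hα ht p = ∫ x in Ioi (0 : ℝ), p.eval x * weight t α x := rfl

theorem functional_mul {t α : ℝ} (hα : -1 < α) (ht : 0 ≤ t) (p q : ℝ[X]) :
    functional hα ht (p * q) = pairing t α p q := by
  simp [functional_apply, pairing]

theorem isMonicOrth {t α : ℝ} (hα : -1 < α) (ht : 0 ≤ t) :
    IsMonicOrth (functional hα ht) (orthPoly t α) (normConst t α) where
  monic := orthPoly_monic t α
  natDegree := natDegree_orthPoly t α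
  orth n k hk := by rw [functional_mul, pairing_orthPoly_of_lt hα ht n k hk]
  norm n := by rw [functional_mul, normConst_eq_pairing]
  norm_ne n := (normConst_pos hα ht n).ne'
  definite p hp := by
    by_contra h
    exact (pairing_self_pos hα ht h).ne' (by rw [← functional_mul hα ht, hp])

theorem normConst_le_pairing {t α : ℝ} (hα : -1 < α) (ht : 0 ≤ t) {n : ℕ} {q : ℝ[X]}
    (hq : q.Monic) (hd : q.natDegree = n) : normConst t α n ≤ pairing t α q q := by
  rw [← functional_mul hα ht, (isMonicOrth hα ht).map_sq_eq n q hq hd, functional_mul]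
  have : 0 ≤ pairing t α (q - orthPoly t α n) (q - orthPoly t α n) :=
    setIntegral_nonneg measurableSet_Ioi fun x hx =>
      mul_nonneg (mul_self_nonneg _) (weight_pos hx).le
  linarith

theorem weight_add_one {t α x : ℝ} (hx : 0 < x) : weight t (α + 1) x = x * weight t α x := by
  rw [weight, weight, Real.rpow_add hx, Real.rpow_one]; ring

theorem a_pos {t α : ℝ} (hα : -1 < α) (ht : 0 ≤ t) (n : ℕ) :
    0 < IsMonicOrth.a (functional hα ht) (orthPoly t α) (normConst t α) n := by
  refine div_pos ?_ (normConst_pos hα ht n)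
  -- A factor x raises α by one, so the numerator of a n is a squared norm for the parameter α + 1.
  have h := pairing_self_pos (t := t) (α := α + 1) (by linarith) ht
    (orthPoly_monic t α n).ne_zero
  rw [pairing] at h
  rw [functional_apply]
  refine h.trans_eq (setIntegral_congr_fun measurableSet_Ioi fun x hx => ?_)
  simp only [eval_mul, eval_X]
  rw [weight_add_one hx]; ring

theorem b_succ_pos {t α : ℝ} (hα : -1 < α) (ht : 0 ≤ t) (n : ℕ) :
    0 < IsMonicOrth.b (normConst t α) (n + 1) :=
  div_pos (normConst_pos hα ht _) (normConst_pos hα ht _)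

theorem b_nonneg {t α : ℝ} (hα : -1 < α) (ht : 0 ≤ t) (n : ℕ) :
    0 ≤ IsMonicOrth.b (normConst t α) n := by
  cases n with
  | zero => exact le_rfl
  | succ n => exact (b_succ_pos hα ht n).le

theorem hasDerivAt_pow_mul_weight {t α x : ℝ} (hx : 0 < x) (k : ℕ) :
    HasDerivAt (fun x : ℝ => x ^ (k + 2) * weight t α x)
      ((k + α + 2) * (x ^ (k + 1) * weight t α x) - x ^ (k + 2) * weight t α x
        + t * (x ^ k * weight t α x)) x := by
  unfold weight
  have h1 := hasDerivAt_pow (k + 2) x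
  have h2 := Real.hasDerivAt_rpow_const (p := α) (Or.inl hx.ne')
  have h3 : HasDerivAt (fun x : ℝ => Real.exp (-x - t / x))
      (Real.exp (-x - t / x) * (-1 + t / x ^ 2)) x := by
    refine HasDerivAt.exp ?_
    have h4 := ((hasDerivAt_id x).neg).sub ((hasDerivAt_const x t).div (hasDerivAt_id x) hx.ne')
    convert! h4 using 1
    simp
    ring
  convert! h1.mul (h2.mul h3) using 1
  rw [Real.rpow_sub_one hx.ne']
  simp only [Pi.mul_apply]
  push_cast
  field_simp
  ring_nf

theorem functional_X_pow {t α : ℝ} (hα : -1 < α) (ht : 0 ≤ t) (k : ℕ) :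
    functional hα ht (X ^ k) = ∫ x in Ioi (0 : ℝ), x ^ k * weight t α x := by
  simp [functional_apply]

/-- The derivative of x^(k+2) w integrates to the difference of the boundary values. At infinity the
limit is zero because the function and its derivative are both integrable. -/
theorem functional_ibp_X_pow {t α : ℝ} (hα : -1 < α) (ht : 0 ≤ t) (k : ℕ) :
    (k + α + 2) * functional hα ht (X ^ (k + 1)) - functional hα ht (X ^ (k + 2))
      + t * functional hα ht (X ^ k) = 0 := by
  have i0 := integrableOn_pow_mul_weight hα ht k
  have i1 := integrableOn_pow_mul_weight hα ht (k + 1)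
  have i2 := integrableOn_pow_mul_weight hα ht (k + 2)
  have i3 := ((i1.const_mul (k + α + 2)).sub i2).add (i0.const_mul t)
  have hd : ∀ x ∈ Ioi (0 : ℝ), HasDerivAt (fun x : ℝ => x ^ (k + 2) * weight t α x) _ x :=
    fun x hx => hasDerivAt_pow_mul_weight hx k
  have h1 := integral_Ioi_of_hasDerivAt_of_tendsto ?_ hd i3
    (tendsto_zero_of_hasDerivAt_of_integrableOn_Ioi hd i3 i2)
  · rw [integral_add (by exact (i1.const_mul (k + α + 2)).sub i2) (i0.const_mul t),
      integral_sub (i1.const_mul (k + α + 2)) i2, integral_const_mul, integral_const_mul] at h1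
    simp only [functional_X_pow, h1]
    simp
  -- At 0 the function is squeezed under x^(k+2+α), whose exponent is positive; this also covers t =
  -- 0.
  · rw [ContinuousWithinAt]
    have hp : 0 < (k : ℝ) + 2 + α := by
      have : (0 : ℝ) ≤ k := k.cast_nonneg
      linarith
    have hc : ContinuousWithinAt (fun x : ℝ => x ^ ((k : ℝ) + 2 + α)) (Ici 0) 0 :=
      (Real.continuousAt_rpow_const _ _ (Or.inr hp.le)).continuousWithinAt
    rw [ContinuousWithinAt, Real.zero_rpow hp.ne'] at hc
    rw [zero_pow (by omega), zero_mul]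
    refine squeeze_zero' ?_ ?_ hc
    · filter_upwards [self_mem_nhdsWithin] with x hx
      have hx : 0 ≤ x := hx
      unfold weight
      positivity
    · filter_upwards [self_mem_nhdsWithin] with x hx
      rcases (show (0 : ℝ) ≤ x from hx).eq_or_lt with rfl | hx
      · rw [zero_pow (by omega), zero_mul]; positivity
      · rw [Real.rpow_add hx, weight]
        have e : x ^ ((k : ℝ) + 2) = x ^ (k + 2) := by exact_mod_cast Real.rpow_natCast x (k + 2)
        rw [e]
        refine mul_le_mul_of_nonneg_left ?_ (by positivity)
        refine mul_le_of_le_one_right (by positivity) (Real.exp_le_one_iff.2 ?_)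
        have : 0 ≤ t / x := by positivity
        linarith

theorem functional_ibp {t α : ℝ} (hα : -1 < α) (ht : 0 ≤ t) (f : ℝ[X]) :
    functional hα ht (X ^ 2 * derivative f) + (α + 2) * functional hα ht (X * f)
      - functional hα ht (X ^ 2 * f) + t * functional hα ht f = 0 := by
  induction f using Polynomial.induction_on' with
  | add p q hp hq =>
    simp only [mul_add, map_add]
    linear_combination hp + hq
  | monomial k c =>
    have h := functional_ibp_X_pow hα ht k
    rw [← C_mul_X_pow_eq_monomial, ← smul_eq_C_mul, derivative_smul, mul_smul_comm, mul_smul_comm,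
      mul_smul_comm, derivative_X_pow, ← pow_succ', ← pow_add, add_comm 2 k, map_smul, map_smul,
      map_smul, map_smul]
    have e : functional hα ht (X ^ 2 * (C (k : ℝ) * X ^ (k - 1)))
        = k * functional hα ht (X ^ (k + 1)) := by
      -- For k = 0 the truncated exponent k - 1 is harmless, its coefficient being zero.
      cases k with
      | zero => simp
      | succ k =>
        rw [← smul_eq_mul (_ : ℝ) (functional hα ht _), ← map_smul, smul_eq_C_mul, Nat.add_sub_cancel]
        congr 1; ring
    rw [e]
    simp only [smul_eq_mul]
    linear_combination c * h

/-! ### The Gaussian variable z = 2 sinh (u / 2) and the Bessel integral. -/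

theorem image_two_mul_sinh_half : (fun u : ℝ => 2 * Real.sinh (u / 2)) '' univ = univ := by
  rw [image_univ, range_eq_univ]
  intro z
  obtain ⟨w, hw⟩ := Real.sinh_surjective (z / 2)
  exact ⟨2 * w, by simp only [mul_div_cancel_left₀ w (two_ne_zero' ℝ), hw]; ring⟩

theorem hasDerivAt_two_mul_sinh_half (u : ℝ) :
    HasDerivAt (fun u : ℝ => 2 * Real.sinh (u / 2)) (Real.cosh (u / 2)) u := by
  convert! (((hasDerivAt_id u).div_const 2).sinh).const_mul 2 using 1
  simp; ring

theorem injective_two_mul_sinh_half : Function.Injective fun u : ℝ => 2 * Real.sinh (u / 2) := by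
  intro u v h
  have := Real.sinh_injective (mul_left_cancel₀ two_ne_zero h)
  linarith

/-- Here cosh (u / 2) is the Jacobian of z = 2 sinh (u / 2), so exp (-s * zsq u) integrates exactly
when accompanied by this factor. -/
theorem integral_cosh_half_mul (g : ℝ → ℝ) :
    ∫ u : ℝ, Real.cosh (u / 2) * g (2 * Real.sinh (u / 2)) = ∫ z, g z := by
  have := integral_image_eq_integral_abs_deriv_smul MeasurableSet.univ
    (fun u _ => (hasDerivAt_two_mul_sinh_half u).hasDerivWithinAt)
    (injective_two_mul_sinh_half.injOn) g
  rw [image_two_mul_sinh_half, setIntegral_univ, setIntegral_univ] at this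
  rw [this]
  simp [abs_of_pos (Real.cosh_pos _)]

theorem integrable_cosh_half_mul {g : ℝ → ℝ} (hg : Integrable g) :
    Integrable fun u : ℝ => Real.cosh (u / 2) * g (2 * Real.sinh (u / 2)) := by
  have := integrableOn_image_iff_integrableOn_abs_deriv_smul MeasurableSet.univ
    (fun u _ => (hasDerivAt_two_mul_sinh_half u).hasDerivWithinAt)
    (injective_two_mul_sinh_half.injOn) g
  rw [image_two_mul_sinh_half, integrableOn_univ, integrableOn_univ] at this
  simpa [abs_of_pos (Real.cosh_pos _)] using this.1 hg

/-- The variable in which the weight becomes Gaussian, squared. -/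
noncomputable def zsq (u : ℝ) : ℝ := (2 * Real.sinh (u / 2)) ^ 2

theorem zsq_nonneg (u : ℝ) : 0 ≤ zsq u := sq_nonneg _

theorem continuous_zsq : Continuous zsq := by unfold zsq; fun_prop

theorem zsq_neg (u : ℝ) : zsq (-u) = zsq u := by
  simp [zsq, neg_div, Real.sinh_neg]

theorem sq_le_zsq (u : ℝ) : u ^ 2 ≤ zsq u := by
  wlog h : 0 ≤ u generalizing u
  · have := this (-u) (by linarith)
    rwa [neg_sq, zsq_neg] at this
  · have h1 : u / 2 ≤ Real.sinh (u / 2) := Real.self_le_sinh_iff.2 (by linarith)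
    exact pow_le_pow_left₀ h (by linarith) 2

theorem zsq_eq (u : ℝ) : zsq u = 2 * Real.cosh u - 2 := by
  have h1 := Real.cosh_two_mul (u / 2)
  have h2 := Real.sinh_sq (u / 2)
  rw [show 2 * (u / 2) = u by ring] at h1
  rw [zsq]
  linear_combination (-2) * h1 + 2 * h2

theorem sub_one_sq_eq (u : ℝ) : (Real.exp u - 1) ^ 2 = Real.exp u * zsq u := by
  have h : Real.exp u * Real.exp (-u) = 1 := by rw [← Real.exp_add]; simp
  rw [zsq_eq, Real.cosh_eq]
  linear_combination (-1) * h

/-- Completing the square, ν u ≤ ν² / 4 + u² ≤ ν² / 4 + zsq u. Exponential growth in u thus costs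
only one unit of the rate s. -/
theorem exp_mul_le (ν u : ℝ) : Real.exp (ν * u) ≤ Real.exp (ν ^ 2 / 4) * Real.exp (zsq u) := by
  rw [← Real.exp_add]
  have := sq_le_zsq u
  exact Real.exp_le_exp.2 (by nlinarith [sq_nonneg (u - ν / 2)])

theorem exp_abs_mul_le (ν u : ℝ) : Real.exp |ν * u| ≤ Real.exp (ν ^ 2 / 4) * Real.exp (zsq u) := by
  rcases abs_cases (ν * u) with h | h
  · rw [h.1]; exact exp_mul_le ν u
  · rw [h.1, ← neg_mul]; simpa using exp_mul_le (-ν) u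

/-- For s ≥ 2 the factor exp w uses at most half of the decay. Of the other half, a quarter of the
rate absorbs w^k through one term of the exponential series, and a quarter is kept for
integrability. -/
theorem pow_mul_exp_le (k : ℕ) {s : ℝ} (hs : 2 ≤ s) {w : ℝ} (hw : 0 ≤ w) :
    w ^ k * Real.exp w * Real.exp (-s * w) ≤ k.factorial * 4 ^ k / s ^ k * Real.exp (-(s / 4) * w) := by
  have h1 := Real.pow_div_factorial_le_exp (s * w / 4) (by positivity) k
  have hk : (0 : ℝ) < k.factorial := by exact_mod_cast k.factorial_pos
  rw [div_le_iff₀ hk, div_pow, div_le_iff₀ (by positivity), mul_pow] at h1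
  have h2 : Real.exp w * Real.exp (-s * w) ≤ Real.exp (-(s * w / 4)) * Real.exp (-(s / 4) * w) := by
    rw [← Real.exp_add, ← Real.exp_add]
    exact Real.exp_le_exp.2 (by nlinarith)
  have h3 : w ^ k ≤ Real.exp (s * w / 4) * k.factorial * 4 ^ k / s ^ k := by
    rw [le_div_iff₀ (by positivity)]; linarith
  calc w ^ k * Real.exp w * Real.exp (-s * w) = w ^ k * (Real.exp w * Real.exp (-s * w)) := by ring
    _ ≤ (Real.exp (s * w / 4) * k.factorial * 4 ^ k / s ^ k)
        * (Real.exp (-(s * w / 4)) * Real.exp (-(s / 4) * w)) := by gcongr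
    _ = (Real.exp (s * w / 4) * Real.exp (-(s * w / 4))) *
        (k.factorial * 4 ^ k / s ^ k * Real.exp (-(s / 4) * w)) := by ring
    _ = _ := by rw [← Real.exp_add]; simp

theorem sqrt_pi_div_quarter {s : ℝ} : √(Real.pi / (s / 4)) = 2 * √(Real.pi / s) := by
  rw [show Real.pi / (s / 4) = 2 ^ 2 * (Real.pi / s) by field_simp; norm_num,
    Real.sqrt_mul (by norm_num), Real.sqrt_sq (by norm_num)]

theorem integrable_quarter {s : ℝ} (hs : 0 < s) :
    Integrable fun u : ℝ => Real.cosh (u / 2) * Real.exp (-(s / 4) * zsq u) :=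
  integrable_cosh_half_mul (integrable_exp_neg_mul_sq (by positivity : 0 < s / 4))

/-- Domination by Gaussians in the variable `2 * sinh (u / 2)`. -/
theorem integrable_and_integral_le {f : ℝ → ℝ} (hf : Continuous f) {c : ℝ} (k : ℕ)
    (h : ∀ u, |f u| ≤ c * (zsq u ^ k * Real.exp (zsq u))) {s : ℝ} (hs : 2 ≤ s) :
    Integrable (fun u => f u * Real.exp (-s * zsq u)) ∧
      |∫ u, f u * Real.exp (-s * zsq u)| ≤
        c * (k.factorial * 4 ^ k) * 2 / s ^ k * √(Real.pi / s) := by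
  have hc : 0 ≤ c := by
    -- Any point with zsq u > 0 would serve to recover 0 ≤ c from the hypothesis.
    have h1 := (abs_nonneg _).trans (h 1)
    have h2 : 0 < zsq 1 := lt_of_lt_of_le (by norm_num) (sq_le_zsq 1)
    exact nonneg_of_mul_nonneg_left h1 (by positivity)
  have hs0 : 0 < s := by linarith
  have hb : ∀ u, ‖f u * Real.exp (-s * zsq u)‖ ≤ c * (k.factorial * 4 ^ k / s ^ k) *
      (Real.cosh (u / 2) * Real.exp (-(s / 4) * zsq u)) := by
    intro u
    rw [norm_mul, Real.norm_eq_abs, Real.norm_of_nonneg (Real.exp_pos _).le]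
    calc |f u| * Real.exp (-s * zsq u)
        ≤ c * (zsq u ^ k * Real.exp (zsq u)) * Real.exp (-s * zsq u) := by gcongr; exact h u
      _ = c * (zsq u ^ k * Real.exp (zsq u) * Real.exp (-s * zsq u)) := by ring
      _ ≤ c * (k.factorial * 4 ^ k / s ^ k * Real.exp (-(s / 4) * zsq u)) := by
        exact mul_le_mul_of_nonneg_left (pow_mul_exp_le k hs (zsq_nonneg u)) hc
      -- Inserting the Jacobian cosh (u / 2) ≥ 1 makes the majorant exactly integrable.
      _ ≤ c * (k.factorial * 4 ^ k / s ^ k * (Real.cosh (u / 2) * Real.exp (-(s / 4) * zsq u))) := by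
        gcongr
        exact le_mul_of_one_le_left (Real.exp_pos _).le (Real.one_le_cosh _)
      _ = _ := by ring
  have hi := (integrable_quarter hs0).const_mul (c * (k.factorial * 4 ^ k / s ^ k))
  refine ⟨Integrable.mono' hi ?_ (Eventually.of_forall hb), ?_⟩
  · exact (hf.mul (by have := continuous_zsq; fun_prop)).aestronglyMeasurable
  · refine (norm_integral_le_of_norm_le hi (Eventually.of_forall hb)).trans ?_
    rw [integral_const_mul]
    have e : ∫ u : ℝ, Real.cosh (u / 2) * Real.exp (-(s / 4) * zsq u) = 2 * √(Real.pi / s) := by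
      rw [← sqrt_pi_div_quarter, ← integral_gaussian]
      exact integral_cosh_half_mul fun z => Real.exp (-(s / 4) * z ^ 2)
    rw [e]
    apply le_of_eq; ring

/-- The derivative of z exp (-s z²) integrates to zero. -/
theorem integral_sq_mul_gaussian {s : ℝ} (hs : 0 < s) :
    Integrable (fun z : ℝ => z ^ 2 * Real.exp (-s * z ^ 2)) ∧
    ∫ z : ℝ, z ^ 2 * Real.exp (-s * z ^ 2) = √(Real.pi / s) / (2 * s) := by
  have i0 := integrable_exp_neg_mul_sq hs
  have i1 := integrable_mul_exp_neg_mul_sq hs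
  have i2 : Integrable (fun z : ℝ => z ^ 2 * Real.exp (-s * z ^ 2)) := by
    have := integrable_rpow_mul_exp_neg_mul_sq hs (s := 2) (by norm_num)
    simpa using this
  refine ⟨i2, ?_⟩
  have h := integral_eq_zero_of_hasDerivAt_of_integrable
    (f := fun z : ℝ => z * Real.exp (-s * z ^ 2))
    (f' := fun z : ℝ => Real.exp (-s * z ^ 2) - 2 * s * (z ^ 2 * Real.exp (-s * z ^ 2))) ?_
    (i0.sub (i2.const_mul _)) i1
  · rw [integral_sub i0 (i2.const_mul _), integral_const_mul, integral_gaussian] at h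
    rw [eq_div_iff (by positivity)]
    linarith
  · intro z
    have h1 : HasDerivAt (fun z : ℝ => Real.exp (-s * z ^ 2))
        (Real.exp (-s * z ^ 2) * (-s * (2 * z))) z := by
      refine HasDerivAt.exp (HasDerivAt.const_mul (-s) ?_)
      simpa using hasDerivAt_pow 2 z
    convert! (hasDerivAt_id z).mul h1 using 1
    simp; ring

theorem abs_exp_sub_le (x : ℝ) :
    |Real.exp x - (1 + x + x ^ 2 / 2 + x ^ 3 / 6)| ≤ x ^ 4 * Real.exp |x| := by
  have h := Complex.norm_exp_sub_sum_le_norm_mul_exp (x : ℂ) 4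
  have e : Complex.exp x - ∑ m ∈ Finset.range 4, (x : ℂ) ^ m / (m.factorial : ℂ)
      = ((Real.exp x - (1 + x + x ^ 2 / 2 + x ^ 3 / 6) : ℝ) : ℂ) := by
    simp [Finset.sum_range_succ, Nat.factorial]
  rw [e, Complex.norm_real, Complex.norm_real, Real.norm_eq_abs, Real.norm_eq_abs] at h
  rwa [(by decide : Even 4).pow_abs] at h

theorem abs_cosh_sub_le (x : ℝ) : |Real.cosh x - (1 + x ^ 2 / 2)| ≤ x ^ 4 * Real.exp |x| := by
  have h1 := abs_le.1 (abs_exp_sub_le x)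
  have h2 := abs_le.1 (abs_exp_sub_le (-x))
  rw [abs_neg] at h2
  rw [Real.cosh_eq, abs_le]
  constructor <;> nlinarith [h1.1, h1.2, h2.1, h2.2]

theorem abs_cosh_mul_sub_le (ν u : ℝ) :
    |Real.cosh (ν * u) - (1 + ν ^ 2 * u ^ 2 / 2)| ≤
      ν ^ 4 * Real.exp (ν ^ 2 / 4) * (zsq u ^ 2 * Real.exp (zsq u)) := by
  have h := abs_cosh_sub_le (ν * u)
  rw [mul_pow, mul_pow] at h
  refine h.trans ?_
  have h1 : u ^ 4 ≤ zsq u ^ 2 := by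
    have := pow_le_pow_left₀ (sq_nonneg u) (sq_le_zsq u) 2
    nlinarith
  calc ν ^ 4 * u ^ 4 * Real.exp |ν * u|
      ≤ ν ^ 4 * zsq u ^ 2 * (Real.exp (ν ^ 2 / 4) * Real.exp (zsq u)) := by
        exact mul_le_mul (mul_le_mul_of_nonneg_left h1 (by positivity)) (exp_abs_mul_le ν u)
          (Real.exp_pos _).le (by positivity)
    _ = _ := by ring

/-- `cosh (ν u)` is interpolated to fourth order at `0` by the two exactly solvable cases. -/
theorem exists_cosh_interpolation (ν : ℝ) : ∃ c, ∀ u,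
    |Real.cosh (ν * u) - ((9 - 4 * ν ^ 2) / 8 * Real.cosh (1 / 2 * u)
      + (4 * ν ^ 2 - 1) / 8 * Real.cosh (3 / 2 * u))| ≤ c * (zsq u ^ 2 * Real.exp (zsq u)) := by
  refine ⟨ν ^ 4 * Real.exp (ν ^ 2 / 4)
    + |(9 - 4 * ν ^ 2) / 8| * ((1 / 2) ^ 4 * Real.exp ((1 / 2) ^ 2 / 4))
    + |(4 * ν ^ 2 - 1) / 8| * ((3 / 2) ^ 4 * Real.exp ((3 / 2) ^ 2 / 4)), fun u => ?_⟩
  have h1 := abs_cosh_mul_sub_le ν u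
  have h2 := mul_le_mul_of_nonneg_left (abs_cosh_mul_sub_le (1 / 2) u)
    (abs_nonneg ((9 - 4 * ν ^ 2) / 8))
  have h3 := mul_le_mul_of_nonneg_left (abs_cosh_mul_sub_le (3 / 2) u)
    (abs_nonneg ((4 * ν ^ 2 - 1) / 8))
  rw [← abs_mul] at h2 h3
  set p := Real.cosh (ν * u) - (1 + ν ^ 2 * u ^ 2 / 2)
  set q := (9 - 4 * ν ^ 2) / 8 * (Real.cosh (1 / 2 * u) - (1 + (1 / 2) ^ 2 * u ^ 2 / 2))
  set r := (4 * ν ^ 2 - 1) / 8 * (Real.cosh (3 / 2 * u) - (1 + (3 / 2) ^ 2 * u ^ 2 / 2))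
  -- The weights A, B solve A + B = 1 and A / 4 + 9 B / 4 = ν², so the Taylor terms of degree 0 and
  -- 2 cancel and only the fourth-order remainders are left.
  have e : Real.cosh (ν * u) - ((9 - 4 * ν ^ 2) / 8 * Real.cosh (1 / 2 * u)
      + (4 * ν ^ 2 - 1) / 8 * Real.cosh (3 / 2 * u)) = p - q - r := by ring
  rw [e]
  have h4 : |p - q - r| ≤ |p| + |q| + |r| :=
    (abs_sub _ _).trans (add_le_add_left (abs_sub _ _) _)
  linarith

theorem integral_cosh_half {s : ℝ} (hs : 0 < s) :
    Integrable (fun u => Real.cosh (1 / 2 * u) * Real.exp (-s * zsq u)) ∧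
    ∫ u, Real.cosh (1 / 2 * u) * Real.exp (-s * zsq u) = √(Real.pi / s) := by
  simp only [one_div_mul_eq_div]
  refine ⟨integrable_cosh_half_mul (integrable_exp_neg_mul_sq hs), ?_⟩
  rw [← integral_gaussian]
  exact integral_cosh_half_mul fun z => Real.exp (-s * z ^ 2)

/-- Since cosh 3v = cosh v (1 + 4 sinh² v), the integrand is the Jacobian times (1 + z²) exp (-s
z²). -/
theorem integral_cosh_three_half {s : ℝ} (hs : 0 < s) :
    Integrable (fun u => Real.cosh (3 / 2 * u) * Real.exp (-s * zsq u)) ∧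
    ∫ u, Real.cosh (3 / 2 * u) * Real.exp (-s * zsq u) = √(Real.pi / s) * (1 + 1 / (2 * s)) := by
  have e : (fun u => Real.cosh (3 / 2 * u) * Real.exp (-s * zsq u)) = fun u =>
      Real.cosh (u / 2) * (fun z : ℝ => Real.exp (-s * z ^ 2) + z ^ 2 * Real.exp (-s * z ^ 2))
        (2 * Real.sinh (u / 2)) := by
    ext u
    have h := Real.cosh_three_mul (u / 2)
    have h2 := Real.sinh_sq (u / 2)
    rw [show 3 / 2 * u = 3 * (u / 2) by ring, h]
    simp only [zsq, mul_pow, h2]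
    ring
  obtain ⟨i2, h2⟩ := integral_sq_mul_gaussian hs
  have i0 := integrable_exp_neg_mul_sq hs
  rw [e]
  refine ⟨integrable_cosh_half_mul (i0.add i2), ?_⟩
  rw [integral_cosh_half_mul fun z : ℝ => Real.exp (-s * z ^ 2) + z ^ 2 * Real.exp (-s * z ^ 2),
    integral_add i0 i2, h2, integral_gaussian]
  ring

theorem integral_exp_mul_eq_cosh (ν : ℝ) {s : ℝ} (hs : 2 ≤ s) :
    ∫ u, Real.exp (ν * u) * Real.exp (-s * zsq u)
      = ∫ u, Real.cosh (ν * u) * Real.exp (-s * zsq u) := by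
  have hi : ∀ μ : ℝ, Integrable (fun u => Real.exp (μ * u) * Real.exp (-s * zsq u)) := fun μ =>
    (integrable_and_integral_le (f := fun u => Real.exp (μ * u)) (by fun_prop) 0
      (c := Real.exp (μ ^ 2 / 4)) (fun u => by
        rw [abs_of_pos (Real.exp_pos _), pow_zero, one_mul]; exact exp_mul_le μ u) hs).1
  have h1 : ∫ u, Real.exp (-ν * u) * Real.exp (-s * zsq u)
      = ∫ u, Real.exp (ν * u) * Real.exp (-s * zsq u) := by
    rw [← integral_neg_eq_self]
    simp [zsq_neg]
  have h2 : (fun u => Real.cosh (ν * u) * Real.exp (-s * zsq u)) = fun u =>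
      2⁻¹ * (Real.exp (ν * u) * Real.exp (-s * zsq u)
        + Real.exp (-ν * u) * Real.exp (-s * zsq u)) := by
    ext u
    rw [Real.cosh_eq, neg_mul ν]; ring
  rw [h2, integral_const_mul, integral_add (hi ν) (hi (-ν)), h1]
  ring

/-- The first two terms of the asymptotic expansion of the modified Bessel function. -/
theorem exists_bessel_asymptotics (ν : ℝ) : ∃ c, ∀ s : ℝ, 2 ≤ s →
    |(∫ u, Real.exp (ν * u) * Real.exp (-s * zsq u))
      - √(Real.pi / s) * (1 + (4 * ν ^ 2 - 1) / (16 * s))| ≤ c / s ^ 2 * √(Real.pi / s) := by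
  obtain ⟨c, hc⟩ := exists_cosh_interpolation ν
  refine ⟨c * ((Nat.factorial 2 : ℕ) * 4 ^ 2) * 2, fun s hs => ?_⟩
  have hs0 : 0 < s := by linarith
  obtain ⟨hi, hb⟩ := integrable_and_integral_le (by fun_prop) 2 hc hs
  obtain ⟨i1, e1⟩ := integral_cosh_half hs0
  obtain ⟨i3, e3⟩ := integral_cosh_three_half hs0
  have i13 := (i1.const_mul ((9 - 4 * ν ^ 2) / 8)).add (i3.const_mul ((4 * ν ^ 2 - 1) / 8))
  have e : ∫ u, Real.cosh (ν * u) * Real.exp (-s * zsq u)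
      = (∫ u, (Real.cosh (ν * u) - ((9 - 4 * ν ^ 2) / 8 * Real.cosh (1 / 2 * u)
      + (4 * ν ^ 2 - 1) / 8 * Real.cosh (3 / 2 * u))) * Real.exp (-s * zsq u))
      + √(Real.pi / s) * (1 + (4 * ν ^ 2 - 1) / (16 * s)) := by
    have e4 : √(Real.pi / s) * (1 + (4 * ν ^ 2 - 1) / (16 * s)) =
        ∫ u, ((9 - 4 * ν ^ 2) / 8 * (Real.cosh (1 / 2 * u) * Real.exp (-s * zsq u))
          + (4 * ν ^ 2 - 1) / 8 * (Real.cosh (3 / 2 * u) * Real.exp (-s * zsq u))) := by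
      rw [integral_add (i1.const_mul _) (i3.const_mul _), integral_const_mul, integral_const_mul,
        e1, e3]
      field_simp; ring
    refine (integral_congr_ae (Eventually.of_forall fun u => ?_)).trans
      ((integral_add hi i13).trans (by rw [e4]; rfl))
    simp only [Pi.add_apply]; ring
  rw [integral_exp_mul_eq_cosh ν hs, e, add_sub_cancel_right]
  exact hb

/-- By `sub_one_sq_eq` the integrand contains zsq u ^ n, and each power of zsq gains a factor 1 / s.
-/
theorem exists_moment_bound (ν : ℝ) (n : ℕ) : ∃ c, ∀ s : ℝ, 2 ≤ s →
    ∫ u, (Real.exp u - 1) ^ (2 * n) * Real.exp (ν * u) * Real.exp (-s * zsq u)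
      ≤ c / s ^ n * √(Real.pi / s) := by
  refine ⟨_, fun s hs => (le_abs_self _).trans (integrable_and_integral_le (by fun_prop) n
    (c := Real.exp ((n + ν) ^ 2 / 4)) (fun u => ?_) hs).2⟩
  have e : (Real.exp u - 1) ^ (2 * n) * Real.exp (ν * u)
      = zsq u ^ n * Real.exp ((n + ν) * u) := by
    rw [pow_mul, sub_one_sq_eq, mul_pow, ← Real.exp_nat_mul, add_mul, Real.exp_add]; ring
  have hz : 0 ≤ zsq u ^ n := pow_nonneg (zsq_nonneg u) n
  rw [e, abs_of_nonneg (mul_nonneg hz (Real.exp_pos _).le)]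
  have := mul_le_mul_of_nonneg_left (exp_mul_le (n + ν) u) hz
  linarith

/-! ### Moments of the weight and the a priori bound on h_n. -/

/-- The substitution `x = s * exp u`. -/
theorem integral_mul_weight (g : ℝ → ℝ) (α : ℝ) {s : ℝ} (hs : 0 < s) :
    ∫ x in Ioi (0 : ℝ), g x * weight (s ^ 2) α x = s ^ (α + 1) * Real.exp (-2 * s) *
      ∫ u, g (s * Real.exp u) * Real.exp ((α + 1) * u) * Real.exp (-s * zsq u) := by
  have him : (fun u : ℝ => s * Real.exp u) '' univ = Ioi 0 := by
    ext x
    simp only [image_univ, mem_range, mem_Ioi]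
    constructor
    · rintro ⟨u, rfl⟩; positivity
    · intro hx
      refine ⟨Real.log (x / s), ?_⟩
      rw [Real.exp_log (by positivity)]; field_simp
  have hinj : InjOn (fun u : ℝ => s * Real.exp u) univ := fun u _ v _ h =>
    Real.exp_injective (mul_left_cancel₀ hs.ne' h)
  have h := integral_image_eq_integral_abs_deriv_smul MeasurableSet.univ
    (fun u _ => ((Real.hasDerivAt_exp u).const_mul s).hasDerivWithinAt) hinj
    (fun x => g x * weight (s ^ 2) α x)
  rw [him, setIntegral_univ] at h
  rw [h, ← integral_const_mul]
  congr 1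
  ext u
  have he : 0 < s * Real.exp u := by positivity
  rw [abs_of_pos he, smul_eq_mul, weight, Real.mul_rpow hs.le (Real.exp_pos u).le,
    ← Real.exp_mul, Real.rpow_add_one hs.ne']
  -- The exponent is -2 s cosh u = -2 s - s * zsq u.
  have e1 : Real.exp (-(s * Real.exp u) - s ^ 2 / (s * Real.exp u))
      = Real.exp (-2 * s) * Real.exp (-s * zsq u) := by
    rw [← Real.exp_add, zsq_eq, Real.cosh_eq, Real.exp_neg]
    congr 1
    have := (Real.exp_pos u).ne'
    field_simp; ring
  have e2 : Real.exp ((α + 1) * u) = Real.exp (u * α) * Real.exp u := by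
    rw [← Real.exp_add]; ring_nf
  rw [e1, e2]; ring

theorem normConst_zero_eq (α : ℝ) {s : ℝ} (hs : 0 < s) :
    normConst (s ^ 2) α 0 = s ^ (α + 1) * Real.exp (-2 * s) *
      ∫ u, Real.exp ((α + 1) * u) * Real.exp (-s * zsq u) := by
  have h0 : orthPoly (s ^ 2) α 0 = 1 :=
    (orthPoly_monic (s ^ 2) α 0).natDegree_eq_zero.1 (natDegree_orthPoly (s ^ 2) α 0)
  have := integral_mul_weight (fun _ => 1) α hs
  simpa [normConst, h0] using this

/-- The minimum property is tested on (X - s)^n, centred at the point x = s where the weight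
concentrates; fluctuations of size √s there give the factor s^n. -/
theorem exists_normConst_le {α : ℝ} (hα : -1 < α) (n : ℕ) : ∃ c, ∀ s : ℝ, 2 ≤ s →
    normConst (s ^ 2) α n ≤ s ^ (α + 1) * Real.exp (-2 * s) * √(Real.pi / s) * (c * s ^ n) := by
  obtain ⟨c, hc⟩ := exists_moment_bound (α + 1) n
  refine ⟨c, fun s hs => ?_⟩
  have hs0 : 0 < s := by linarith
  refine (normConst_le_pairing hα (sq_nonneg s) ((monic_X_sub_C s).pow n)
    (by rw [natDegree_pow, natDegree_X_sub_C, mul_one])).trans ?_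
  have e : pairing (s ^ 2) α ((X - C s) ^ n) ((X - C s) ^ n) =
      ∫ x in Ioi (0 : ℝ), (x - s) ^ (2 * n) * weight (s ^ 2) α x := by
    simp only [pairing, eval_pow, eval_sub, eval_X, eval_C]
    congr 1; ext x; ring
  rw [e, integral_mul_weight _ α hs0]
  have e2 : ∀ u, (s * Real.exp u - s) ^ (2 * n) * Real.exp ((α + 1) * u) * Real.exp (-s * zsq u)
      = s ^ (2 * n) * ((Real.exp u - 1) ^ (2 * n) * Real.exp ((α + 1) * u)
        * Real.exp (-s * zsq u)) := by
    intro u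
    rw [show s * Real.exp u - s = s * (Real.exp u - 1) by ring, mul_pow]; ring
  simp only [e2]
  rw [integral_const_mul]
  calc _ ≤ s ^ (α + 1) * Real.exp (-2 * s) * (s ^ (2 * n) * (c / s ^ n * √(Real.pi / s))) := by
        gcongr; exact hc s hs
    _ = _ := by
      have : s ^ (2 * n) * (c / s ^ n) = c * s ^ n := by
        rw [two_mul, pow_add]; field_simp
      linear_combination (s ^ (α + 1) * Real.exp (-2 * s) * √(Real.pi / s)) * this

/-! ### Limits with rate 1 / s. -/

theorem isBigO_inv_one : (fun s : ℝ => s⁻¹) =O[atTop] (fun _ => (1 : ℝ)) :=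
  tendsto_inv_atTop_zero.isBigO_one ℝ

theorem isBigO_sum_apply {F : ℕ → ℝ → ℝ} {g : ℝ → ℝ} {u : Finset ℕ}
    (h : ∀ j ∈ u, F j =O[atTop] g) : (fun s => ∑ j ∈ u, F j s) =O[atTop] g := by
  simpa only [Finset.sum_fn] using IsBigO.sum h

/-- `f` converges to `l` at rate `1 / s`. -/
def Approx (f : ℝ → ℝ) (l : ℝ) : Prop :=
  (fun s => f s - l) =O[atTop] (fun s : ℝ => s⁻¹)

namespace Approx

variable {f g : ℝ → ℝ} {l m : ℝ}

theorem const (c : ℝ) : Approx (fun _ => c) c := by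
  simpa [Approx] using isBigO_zero _ _

theorem isBigO_one (h : Approx f l) : f =O[atTop] (fun _ => (1 : ℝ)) := by
  have := (h.trans isBigO_inv_one).add (isBigO_const_const l one_ne_zero atTop)
  simpa using this

theorem add (hf : Approx f l) (hg : Approx g m) : Approx (fun s => f s + g s) (l + m) := by
  refine (IsBigO.add hf hg).congr_left fun s => ?_
  ring

theorem mul (hf : Approx f l) (hg : Approx g m) : Approx (fun s => f s * g s) (l * m) := by
  have h1 := IsBigO.mul hf hg.isBigO_one
  have h2 := IsBigO.const_mul_left hg l
  simp only [mul_one] at h1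
  refine (h1.add h2).congr_left fun s => ?_
  ring

theorem const_mul (c : ℝ) (hf : Approx f l) : Approx (fun s => c * f s) (c * l) :=
  (const c).mul hf

theorem sub (hf : Approx f l) (hg : Approx g m) : Approx (fun s => f s - g s) (l - m) := by
  refine (IsBigO.sub hf hg).congr_left fun s => ?_
  ring

theorem sum {F : ℕ → ℝ → ℝ} {c : ℕ → ℝ} (h : ∀ j, Approx (F j) (c j)) (n : ℕ) :
    Approx (fun s => ∑ j ∈ Finset.range n, F j s) (∑ j ∈ Finset.range n, c j) := by
  refine (isBigO_sum_apply fun j (_ : j ∈ Finset.range n) => h j).congr_left fun s => ?_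
  rw [Finset.sum_sub_distrib]

theorem inv_mul (hf : f =O[atTop] (fun _ => (1 : ℝ))) : Approx (fun s => s⁻¹ * f s) 0 := by
  have := (isBigO_refl (fun s : ℝ => s⁻¹) atTop).mul hf
  simpa [Approx] using this

end Approx

/-! ### Asymptotic analysis of the scaled string equations. -/

/-- The scaled recurrence coefficients, as functions of the square root `s` of the parameter. -/
structure StringSystem (α : ℝ) (y c : ℕ → ℝ → ℝ) : Prop where
  y_pos : ∀ n s, 2 ≤ s → 0 < y n s
  c_nonneg : ∀ n s, 2 ≤ s → 0 ≤ c n s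
  c_zero : ∀ s, c 0 s = 0
  one : ∀ n s, 2 ≤ s → c (n + 1) s + c n s = s * (1 - y n s ^ 2) + (2 * n + α + 2) * y n s
    + 2 * ∑ j ∈ Finset.range n, y j s
  two : ∀ n s, 2 ≤ s → c (n + 1) s * (y (n + 1) s + y n s - s⁻¹ * (2 * n + 3 + α)) =
    ∑ j ∈ Finset.range (n + 1), y j s ^ 2 + 2 * s⁻¹ * ∑ j ∈ Finset.range (n + 1), c j s
  prod_bdd : ∀ n, (fun s => ∏ j ∈ Finset.range n, c (j + 1) s) =O[atTop] (fun _ => (1 : ℝ))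

namespace StringSystem

variable {α : ℝ} {y c : ℕ → ℝ → ℝ}

/-- The scaled deviation of `y n` from its limit. -/
def dev (y : ℕ → ℝ → ℝ) (n : ℕ) (s : ℝ) : ℝ := s * (y n s - 1)

/-- The left side of `one` is nonnegative, so s (y² - 1) is at most linear in y plus a sum that is
bounded by induction; a large y is impossible. -/
theorem y_bdd (H : StringSystem α y c) (n : ℕ) : (y n) =O[atTop] (fun _ => (1 : ℝ)) := by
  induction n using Nat.strong_induction_on with
  | _ n ih =>
    obtain ⟨C, hC⟩ := (isBigO_sum_apply fun j (hj : j ∈ Finset.range n) =>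
      ih j (Finset.mem_range.1 hj)).bound
    -- Beyond this bound y² > 1 + k y + 2 |C| with k = |2 n + α + 2|, contradicting y² - 1 ≤ k y + 2
    -- |C|.
    refine IsBigO.of_bound (1 + |2 * n + α + 2| + 2 * |C|) ?_
    filter_upwards [hC, eventually_ge_atTop 2] with s h1 h2
    have hy := H.y_pos n s h2
    rw [norm_one, mul_one, Real.norm_eq_abs] at h1 ⊢
    rw [abs_of_pos hy]
    have e := H.one n s h2
    have c0 := H.c_nonneg n s h2
    have c1 := H.c_nonneg (n + 1) s h2
    have h3 : (2 * n + α + 2) * y n s ≤ |2 * n + α + 2| * y n s := by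
      gcongr; exact le_abs_self _
    have h4 := (le_abs_self _).trans (h1.trans (le_abs_self C))
    by_contra! h5
    set k := |2 * (n : ℝ) + α + 2|
    have hk : 0 ≤ k := abs_nonneg _
    have hc : 0 ≤ |C| := abs_nonneg _
    have h6 : 1 < y n s := by linarith
    have h7 : (1 + k + 2 * |C|) * y n s < y n s * y n s := by gcongr
    have h8 : 1 + k * y n s + 2 * |C| < y n s ^ 2 := by nlinarith
    have h9 : y n s ^ 2 - 1 ≤ s * (y n s ^ 2 - 1) :=
      le_mul_of_one_le_left (by nlinarith) (by linarith)
    nlinarith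

/-- The three bounds feed each other. The product bound `prod_bdd` divided by the lower bound on the
shorter product bounds c (n + 1); then `one` bounds dev y n; then `two` keeps c (n + 1) away from 0,
which extends the lower bound on the product. -/
theorem bounds (H : StringSystem α y c) (n : ℕ) :
    (∀ j < n, dev y j =O[atTop] (fun _ => (1 : ℝ))) ∧
    (∀ j ≤ n, c j =O[atTop] (fun _ => (1 : ℝ))) ∧
    (fun _ : ℝ => (1 : ℝ)) =O[atTop] (fun s => ∏ j ∈ Finset.range n, c (j + 1) s) := by
  induction n with
  | zero =>
    refine ⟨fun j hj => absurd hj (Nat.not_lt_zero j), fun j hj => ?_, ?_⟩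
    · obtain rfl : j = 0 := by omega
      exact (isBigO_zero (E' := ℝ) (fun _ : ℝ => (1 : ℝ)) atTop).congr_left
        fun s => (H.c_zero s).symm
    · simpa using isBigO_refl (fun _ : ℝ => (1 : ℝ)) atTop
  | succ n ih =>
    obtain ⟨hA, hc, hp⟩ := ih
    have hc1 : c (n + 1) =O[atTop] (fun _ => (1 : ℝ)) := by
      have h1 := (H.prod_bdd (n + 1)).mul (hp.inv_rev (by simp))
      refine h1.congr' ?_ (Eventually.of_forall fun s => by norm_num)
      obtain ⟨C, hC⟩ := hp.bound
      filter_upwards [hC] with s hs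
      have h3 : ∏ j ∈ Finset.range n, c (j + 1) s ≠ 0 := by
        intro h0
        rw [h0] at hs
        norm_num at hs
      rw [Finset.prod_range_succ]
      field_simp
    have hc' : ∀ j ≤ n + 1, c j =O[atTop] (fun _ => (1 : ℝ)) := by
      intro j hj
      rcases hj.eq_or_lt with rfl | hj
      · exact hc1
      · exact hc j (by omega)
    have hAn : dev y n =O[atTop] (fun _ => (1 : ℝ)) := by
      -- By `one` this expression equals dev y n * (1 + y n), and 1 + y n ≥ 1.
      have h1 : (fun s => (2 * n + α + 2) * y n s + 2 * ∑ j ∈ Finset.range n, y j s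
          - c (n + 1) s - c n s) =O[atTop] (fun _ => (1 : ℝ)) :=
        ((((H.y_bdd n).const_mul_left _).add ((isBigO_sum_apply fun j (_ : j ∈ Finset.range n) => H.y_bdd j).const_mul_left 2)).sub
          hc1).sub (hc n le_rfl)
      refine IsBigO.trans (IsBigO.of_bound 1 ?_) h1
      filter_upwards [eventually_ge_atTop 2] with s hs
      have e := H.one n s hs
      have hy := H.y_pos n s hs
      have e2 : (2 * n + α + 2) * y n s + 2 * ∑ j ∈ Finset.range n, y j s
          - c (n + 1) s - c n s = dev y n s * (1 + y n s) := by
        rw [dev]; linear_combination -e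
      rw [e2, norm_mul, one_mul, Real.norm_of_nonneg (by linarith : 0 ≤ 1 + y n s)]
      exact le_mul_of_one_le_right (norm_nonneg _) (by linarith)
    have hA' : ∀ j < n + 1, dev y j =O[atTop] (fun _ => (1 : ℝ)) := by
      intro j hj
      rcases (Nat.lt_succ_iff.1 hj).eq_or_lt with rfl | hj
      · exact hAn
      · exact hA j hj
    refine ⟨hA', hc', ?_⟩
    have h1c : (fun _ : ℝ => (1 : ℝ)) =O[atTop] c (n + 1) := by
      have hy0 : Tendsto (y 0) atTop (nhds 1) := by
        have h1 := Approx.inv_mul (hA' 0 (Nat.succ_pos n))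
        have h2 := (IsBigO.trans_tendsto h1 tendsto_inv_atTop_zero).add_const 1
        rw [zero_add] at h2
        refine h2.congr' ?_
        filter_upwards [eventually_ge_atTop 2] with s hs
        have : s ≠ 0 := by linarith
        rw [dev]; field_simp; ring
      -- In `two` the right side is at least y 0 ² > 1 / 4, while the factor multiplying c (n + 1)
      -- is at most |C| + |2 n + 3 + α|; hence the constant 4 below.
      obtain ⟨C, hC⟩ := ((H.y_bdd (n + 1)).add (H.y_bdd n)).bound
      refine IsBigO.of_bound (4 * (|C| + |2 * n + 3 + α|)) ?_
      filter_upwards [hC, eventually_ge_atTop 2,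
        hy0.eventually_const_lt (show (1 / 2 : ℝ) < 1 by norm_num)] with s h1 h2 h3
      have e := H.two n s h2
      have hcn := H.c_nonneg (n + 1) s h2
      rw [norm_one, mul_one] at h1
      rw [norm_one, Real.norm_of_nonneg hcn]
      have h4 : y (n + 1) s + y n s ≤ |C| := (le_abs_self _).trans (h1.trans (le_abs_self _))
      have h5 : -(s⁻¹ * (2 * n + 3 + α)) ≤ |2 * n + 3 + α| := by
        have hs1 : s⁻¹ ≤ 1 := inv_le_one_of_one_le₀ (by linarith)
        have hs0 : 0 ≤ s⁻¹ := by positivity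
        calc -(s⁻¹ * (2 * n + 3 + α)) ≤ |s⁻¹ * (2 * n + 3 + α)| := neg_le_abs _
          _ = s⁻¹ * |2 * n + 3 + α| := by rw [abs_mul, abs_of_nonneg hs0]
          _ ≤ 1 * |2 * n + 3 + α| := by gcongr
          _ = _ := one_mul _
      have h6 : y 0 s ^ 2 ≤ ∑ j ∈ Finset.range (n + 1), y j s ^ 2 :=
        Finset.single_le_sum (f := fun j => y j s ^ 2) (fun j _ => sq_nonneg _)
          (Finset.mem_range.2 (Nat.succ_pos n))
      have h7 : 0 ≤ 2 * s⁻¹ * ∑ j ∈ Finset.range (n + 1), c j s :=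
        mul_nonneg (by positivity) (Finset.sum_nonneg fun j _ => H.c_nonneg j s h2)
      have h8 : c (n + 1) s * (y (n + 1) s + y n s - s⁻¹ * (2 * n + 3 + α))
          ≤ c (n + 1) s * (|C| + |2 * n + 3 + α|) := by
        gcongr; linarith
      nlinarith
    have := hp.mul h1c
    simp only [one_mul] at this
    refine this.congr_right fun s => ?_
    rw [Finset.prod_range_succ]

theorem dev_bdd (H : StringSystem α y c) (n : ℕ) : dev y n =O[atTop] (fun _ => (1 : ℝ)) :=
  (H.bounds (n + 1)).1 n (Nat.lt_succ_self n)

theorem c_bdd (H : StringSystem α y c) (n : ℕ) : c n =O[atTop] (fun _ => (1 : ℝ)) :=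
  (H.bounds n).2.1 n le_rfl

/-- The correction term of order `1 / s` in `2 * c (n + 1)`. -/
noncomputable def corr (α : ℝ) (y c : ℕ → ℝ → ℝ) (n : ℕ) (s : ℝ) : ℝ :=
  2 * ∑ j ∈ Finset.range (n + 1), dev y j s + s⁻¹ * ∑ j ∈ Finset.range (n + 1), dev y j s ^ 2
    + 2 * ∑ j ∈ Finset.range (n + 1), c j s
    - c (n + 1) s * (dev y (n + 1) s + dev y n s - (2 * n + 3 + α))

theorem y_eq {s : ℝ} (hs : s ≠ 0) (n : ℕ) : y n s = 1 + s⁻¹ * dev y n s := by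
  rw [dev]; field_simp; ring

/-- This is `two` exactly, after y = 1 + dev / s. Boundedness of `corr` gives the limit of c, and
the limit of `corr` gives its next term. -/
theorem two_mul_c_succ (H : StringSystem α y c) (n : ℕ) {s : ℝ} (hs : 2 ≤ s) :
    2 * c (n + 1) s = (n + 1) + s⁻¹ * corr α y c n s := by
  have h := H.two n s hs
  have hs0 : s ≠ 0 := by linarith
  have e : ∑ j ∈ Finset.range (n + 1), y j s ^ 2 = (n + 1)
      + 2 * s⁻¹ * ∑ j ∈ Finset.range (n + 1), dev y j s
      + s⁻¹ ^ 2 * ∑ j ∈ Finset.range (n + 1), dev y j s ^ 2 := by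
    have : ∀ j, y j s ^ 2 = 1 + 2 * s⁻¹ * dev y j s + s⁻¹ ^ 2 * dev y j s ^ 2 := fun j => by
      rw [y_eq (y := y) hs0 j]; ring
    simp only [this, Finset.sum_add_distrib, ← Finset.mul_sum]
    simp
  rw [e, y_eq (y := y) hs0 n, y_eq (y := y) hs0 (n + 1)] at h
  rw [corr]
  linear_combination h

theorem corr_bdd (H : StringSystem α y c) (n : ℕ) :
    corr α y c n =O[atTop] (fun _ => (1 : ℝ)) := by
  have hsq : ∀ j, (fun s => dev y j s ^ 2) =O[atTop] (fun _ => (1 : ℝ)) := fun j => by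
    simpa using (H.dev_bdd j).pow 2
  have h1 := (isBigO_sum_apply fun j (_ : j ∈ Finset.range (n + 1)) => H.dev_bdd j).const_mul_left 2
  have h2 := isBigO_inv_one.mul (isBigO_sum_apply fun j (_ : j ∈ Finset.range (n + 1)) => hsq j)
  have h3 := (isBigO_sum_apply fun j (_ : j ∈ Finset.range (n + 1)) => H.c_bdd j).const_mul_left 2
  have h4 := (H.c_bdd (n + 1)).mul (((H.dev_bdd (n + 1)).add (H.dev_bdd n)).sub
    (isBigO_const_const (2 * (n : ℝ) + 3 + α) one_ne_zero atTop))
  simp only [mul_one] at h2 h4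
  exact (((h1.add h2).add h3).sub h4).congr_left fun s => rfl

theorem approx_c (H : StringSystem α y c) (n : ℕ) : Approx (c n) (n / 2) := by
  cases n with
  | zero =>
    refine (Approx.const 0).congr' (Eventually.of_forall fun s => ?_) EventuallyEq.rfl
    simp [H.c_zero]
  | succ n =>
    have h := (Approx.inv_mul (H.corr_bdd n)).const_mul (1 / 2)
    refine h.congr' ?_ EventuallyEq.rfl
    filter_upwards [eventually_ge_atTop 2] with s hs
    have := H.two_mul_c_succ n hs
    push_cast
    linear_combination (-1 / 2) * this

/-- The same substitution in `one`: once the c's have limits, so does dev. -/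
theorem two_mul_dev (H : StringSystem α y c) (n : ℕ) {s : ℝ} (hs : 2 ≤ s) :
    2 * dev y n s = 4 * n + α + 2 - c (n + 1) s - c n s
      + s⁻¹ * ((2 * n + α + 2) * dev y n s + 2 * ∑ j ∈ Finset.range n, dev y j s
        - dev y n s ^ 2) := by
  have h := H.one n s hs
  have hs0 : s ≠ 0 := by linarith
  have e : ∑ j ∈ Finset.range n, y j s = n + s⁻¹ * ∑ j ∈ Finset.range n, dev y j s := by
    have : ∀ j, y j s = 1 + s⁻¹ * dev y j s := fun j => y_eq hs0 j
    simp only [this, Finset.sum_add_distrib, ← Finset.mul_sum]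
    simp
  have e2 : s * s⁻¹ = 1 := mul_inv_cancel₀ hs0
  rw [e, y_eq (y := y) hs0 n] at h
  linear_combination h - (2 * dev y n s + dev y n s ^ 2 * s⁻¹) * e2

theorem approx_dev (H : StringSystem α y c) (n : ℕ) :
    Approx (dev y n) ((α + 3 * n + 3 / 2) / 2) := by
  have hsq : (fun s => dev y n s ^ 2) =O[atTop] (fun _ => (1 : ℝ)) := by
    simpa using (H.dev_bdd n).pow 2
  have h1 := Approx.inv_mul ((((H.dev_bdd n).const_mul_left (2 * n + α + 2)).add
    ((isBigO_sum_apply fun j (_ : j ∈ Finset.range n) => H.dev_bdd j).const_mul_left 2)).sub hsq)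
  have h2 := ((((Approx.const (4 * n + α + 2)).sub (H.approx_c (n + 1))).sub
    (H.approx_c n)).add h1).const_mul (1 / 2)
  refine h2.congr' ?_ EventuallyEq.rfl
  filter_upwards [eventually_ge_atTop 2] with s hs
  have := H.two_mul_dev n hs
  push_cast
  linear_combination (-1 / 2) * this

theorem sum_dev_limit (n : ℕ) : ∑ j ∈ Finset.range n, (α + 3 * (j : ℝ) + 3 / 2) / 2
    = n * (α + 3 * n / 2) / 2 := by
  induction n with
  | zero => simp
  | succ n ih => rw [Finset.sum_range_succ, ih]; push_cast; ring

theorem sum_c_limit (n : ℕ) : ∑ j ∈ Finset.range n, (j : ℝ) / 2 = n * (n - 1) / 4 := by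
  induction n with
  | zero => simp
  | succ n ih => rw [Finset.sum_range_succ, ih]; push_cast; ring

theorem approx_corr (H : StringSystem α y c) (n : ℕ) :
    Approx (corr α y c n) ((n + 1) * (α + 3 * (n + 1) / 2)) := by
  have hsq : ∀ j, (fun s => dev y j s ^ 2) =O[atTop] (fun _ => (1 : ℝ)) := fun j => by
    simpa using (H.dev_bdd j).pow 2
  have h1 := (Approx.sum H.approx_dev (n + 1)).const_mul 2
  have h2 := Approx.inv_mul (isBigO_sum_apply fun j (_ : j ∈ Finset.range (n + 1)) => hsq j)
  have h3 := (Approx.sum H.approx_c (n + 1)).const_mul 2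
  have h4 := (H.approx_c (n + 1)).mul (((H.approx_dev (n + 1)).add (H.approx_dev n)).sub
    (Approx.const (2 * n + 3 + α)))
  have h5 := ((h1.add h2).add h3).sub h4
  rw [sum_dev_limit, sum_c_limit] at h5
  refine IsBigO.congr_left h5 fun s => ?_
  rw [corr]
  push_cast; ring

/-- The off-diagonal recurrence coefficients to second order. -/
theorem c_succ_asymptotics (H : StringSystem α y c) (n : ℕ) :
    (fun s => c (n + 1) s * (2 / (n + 1)) - 1 - (α + 3 * (n + 1) / 2) / s)
      =O[atTop] (fun s : ℝ => (s ^ 2)⁻¹) := by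
  have h := (isBigO_refl (fun s : ℝ => s⁻¹) atTop).mul
    ((H.approx_corr n).const_mul_left (1 / (n + 1)))
  refine h.congr' ?_ (Eventually.of_forall fun s => by ring)
  filter_upwards [eventually_ge_atTop 2] with s hs
  have e := H.two_mul_c_succ n hs
  have hs0 : s ≠ 0 := by linarith
  have hn : (n : ℝ) + 1 ≠ 0 := by positivity
  have e2 : c (n + 1) s * (2 / (n + 1)) = 2 * c (n + 1) s / (n + 1) := by ring
  rw [e2, e]
  field_simp
  ring

end StringSystem

/-! ### Logarithms and assembly. -/

theorem abs_log_sub_le {x : ℝ} (hx : |x| ≤ 1 / 2) : |Real.log (1 + x) - x| ≤ 2 * x ^ 2 := by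
  obtain ⟨h1, h2⟩ := abs_le.1 hx
  have h0 : 0 < 1 + x := by linarith
  have h3 := Real.log_le_sub_one_of_pos h0
  have h4 := Real.one_sub_inv_le_log_of_pos h0
  have h5 : x - 2 * x ^ 2 ≤ 1 - (1 + x)⁻¹ := by
    have : 1 - (1 + x)⁻¹ = x / (1 + x) := by field_simp; ring
    rw [this, le_div_iff₀ h0]
    nlinarith [mul_nonneg (sq_nonneg x) (by linarith : 0 ≤ 1 + 2 * x)]
  rw [abs_le]
  constructor <;> nlinarith [sq_nonneg x]

theorem log_asymptotics {r : ℝ → ℝ} {k : ℝ}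
    (h : (fun s => r s - 1 - k / s) =O[atTop] (fun s : ℝ => (s ^ 2)⁻¹)) :
    (fun s => Real.log (r s) - k / s) =O[atTop] (fun s : ℝ => (s ^ 2)⁻¹) := by
  have hsq : (fun s : ℝ => (s ^ 2)⁻¹) =O[atTop] (fun s : ℝ => s⁻¹) := by
    have := (isBigO_refl (fun s : ℝ => s⁻¹) atTop).mul isBigO_inv_one
    exact this.congr (fun s => by ring) (fun s => by ring)
  have h1 : (fun s => r s - 1) =O[atTop] (fun s : ℝ => s⁻¹) := by
    have := (h.trans hsq).add ((isBigO_refl (fun s : ℝ => s⁻¹) atTop).const_mul_left k)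
    exact this.congr_left fun s => by ring
  have h2 : (fun s => Real.log (r s) - (r s - 1)) =O[atTop] (fun s : ℝ => (s ^ 2)⁻¹) := by
    have h3 : (fun s => (r s - 1) ^ 2) =O[atTop] (fun s : ℝ => (s ^ 2)⁻¹) := by
      simpa using h1.pow 2
    refine IsBigO.trans (IsBigO.of_bound 2 ?_) h3
    have h4 := (h1.trans_tendsto tendsto_inv_atTop_zero).abs
    rw [abs_zero] at h4
    filter_upwards [h4.eventually_le_const (show (0 : ℝ) < 1 / 2 by norm_num)] with s hs
    have := abs_log_sub_le hs
    rw [Real.norm_eq_abs, Real.norm_of_nonneg (sq_nonneg _)]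
    rwa [add_sub_cancel] at this
  exact (h2.add h).congr_left fun s => by ring

/-- The leading behaviour of the zeroth moment. -/
noncomputable def scale (α s : ℝ) : ℝ := s ^ (α + 1) * Real.exp (-2 * s) * √(Real.pi / s)

theorem scale_pos (α : ℝ) {s : ℝ} (hs : 0 < s) : 0 < scale α s := by
  have := Real.pi_pos
  unfold scale
  positivity

theorem log_scale (α : ℝ) {s : ℝ} (hs : 0 < s) :
    Real.log (scale α s) = -2 * s + (α + 1 / 2) * Real.log s + Real.log Real.pi / 2 := by
  have h1 := Real.pi_pos
  have h2 : 0 < s ^ (α + 1) := Real.rpow_pos_of_pos hs _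
  rw [scale, Real.log_mul (by positivity) (by positivity), Real.log_mul (by positivity)
    (by positivity), Real.log_rpow hs, Real.log_exp, Real.log_sqrt (by positivity),
    Real.log_div h1.ne' hs.ne']
  ring

theorem normConst_zero_asymptotics (α : ℝ) :
    (fun s => normConst (s ^ 2) α 0 / scale α s - 1 - (4 * (α + 1) ^ 2 - 1) / 16 / s)
      =O[atTop] (fun s : ℝ => (s ^ 2)⁻¹) := by
  obtain ⟨c, hc⟩ := exists_bessel_asymptotics (α + 1)
  refine IsBigO.of_bound c ?_
  filter_upwards [eventually_ge_atTop 2] with s hs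
  have hs0 : 0 < s := by linarith
  have hp : 0 < √(Real.pi / s) := Real.sqrt_pos.2 (div_pos Real.pi_pos hs0)
  have hq : 0 < s ^ (α + 1) := Real.rpow_pos_of_pos hs0 _
  have h := hc s hs
  rw [normConst_zero_eq α hs0, scale]
  set I := ∫ u, Real.exp ((α + 1) * u) * Real.exp (-s * zsq u)
  have e : s ^ (α + 1) * Real.exp (-2 * s) * I / (s ^ (α + 1) * Real.exp (-2 * s) * √(Real.pi / s))
      - 1 - (4 * (α + 1) ^ 2 - 1) / 16 / s
      = (I - √(Real.pi / s) * (1 + (4 * (α + 1) ^ 2 - 1) / (16 * s))) / √(Real.pi / s) := by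
    rw [mul_div_mul_left _ _ (by positivity)]
    field_simp
    ring
  rw [e, Real.norm_eq_abs, abs_div, abs_of_pos hp, div_le_iff₀ hp,
    Real.norm_of_nonneg (by positivity)]
  exact h

theorem prod_b_eq {h : ℕ → ℝ} (hh : ∀ n, h n ≠ 0) (n : ℕ) :
    h n = h 0 * ∏ j ∈ Finset.range n, IsMonicOrth.b h (j + 1) := by
  induction n with
  | zero => simp
  | succ n ih =>
    rw [Finset.prod_range_succ, ← mul_assoc, ← ih, IsMonicOrth.b, mul_div_cancel₀ _ (hh n)]

/-- The scaled off-diagonal recurrence coefficients. -/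
noncomputable def scaledB (α : ℝ) (n : ℕ) (s : ℝ) : ℝ :=
  IsMonicOrth.b (normConst (s ^ 2) α) n / s

theorem normConst_eq_prod {α : ℝ} (hα : -1 < α) (n : ℕ) {s : ℝ} (hs : 0 < s) :
    normConst (s ^ 2) α n =
      normConst (s ^ 2) α 0 * (s ^ n * ∏ j ∈ Finset.range n, scaledB α (j + 1) s) := by
  conv_lhs => rw [prod_b_eq (fun n => (normConst_pos hα (sq_nonneg s) n).ne') n]
  simp only [scaledB]
  rw [Finset.prod_div_distrib, Finset.prod_const, Finset.card_range,
    mul_div_cancel₀ _ (pow_ne_zero n hs.ne')]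

theorem stringSystem {α : ℝ} (hα : -1 < α) :
    StringSystem α (fun n s => IsMonicOrth.a (functional hα (sq_nonneg s))
      (orthPoly (s ^ 2) α) (normConst (s ^ 2) α) n / s) (scaledB α) where
  y_pos n s hs := div_pos (a_pos hα (sq_nonneg s) n) (by linarith)
  c_nonneg n s hs := div_nonneg (b_nonneg hα (sq_nonneg s) n) (by linarith)
  c_zero s := by simp [scaledB, IsMonicOrth.b]
  one n s hs := by
    have h := (isMonicOrth hα (sq_nonneg s)).string_one (functional_ibp hα (sq_nonneg s)) n
    have hs0 : s ≠ 0 := by linarith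
    rw [scaledB, scaledB, ← add_div, h, ← Finset.sum_div]
    field_simp
    ring
  two n s hs := by
    have h := (isMonicOrth hα (sq_nonneg s)).string_two (functional_ibp hα (sq_nonneg s)) n
    have hs0 : s ≠ 0 := by linarith
    simp only [scaledB, div_pow]
    rw [← Finset.sum_div, ← Finset.sum_div]
    field_simp
    linear_combination h
  -- The product is h_n / (h_0 s^n): h_n is bounded above by the test polynomial, and h_0 eventually
  -- exceeds half of `scale`.
  prod_bdd n := by
    obtain ⟨c, hc⟩ := exists_normConst_le hα n
    have h0 : Tendsto (fun s => normConst (s ^ 2) α 0 / scale α s) atTop (nhds 1) := by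
      have h1 : Tendsto (fun s : ℝ => (s ^ 2)⁻¹) atTop (nhds 0) :=
        tendsto_inv_atTop_zero.comp (tendsto_pow_atTop two_ne_zero)
      have h2 := (normConst_zero_asymptotics α).trans_tendsto h1
      have h3 : Tendsto (fun s : ℝ => (4 * (α + 1) ^ 2 - 1) / 16 / s) atTop (nhds 0) :=
        tendsto_const_nhds.div_atTop tendsto_id
      have h4 := (h2.add h3).add_const 1
      rw [add_zero, zero_add] at h4
      exact h4.congr fun s => by ring
    refine IsBigO.of_bound (2 * |c|) ?_
    filter_upwards [eventually_ge_atTop 2,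
      h0.eventually_const_lt (show (1 / 2 : ℝ) < 1 by norm_num)] with s hs h1
    have hs0 : 0 < s := by linarith
    have hsc := scale_pos α hs0
    have h2 := hc s hs
    rw [normConst_eq_prod hα n hs0] at h2
    rw [lt_div_iff₀ hsc] at h1
    set p := ∏ j ∈ Finset.range n, scaledB α (j + 1) s
    have hp : 0 ≤ p := Finset.prod_nonneg fun j _ =>
      div_nonneg (b_nonneg hα (sq_nonneg s) _) hs0.le
    rw [norm_one, mul_one, Real.norm_of_nonneg hp]
    have h3 : scale α s * (s ^ n * (1 / 2 * p)) ≤ scale α s * (s ^ n * |c|) := by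
      calc scale α s * (s ^ n * (1 / 2 * p)) = (1 / 2 * scale α s) * (s ^ n * p) := by ring
        _ ≤ normConst (s ^ 2) α 0 * (s ^ n * p) := by gcongr
        _ ≤ scale α s * (c * s ^ n) := h2
        _ ≤ scale α s * (s ^ n * |c|) := by
          rw [mul_comm c]; gcongr; exact le_abs_self c
    have h4 := le_of_mul_le_mul_left (le_of_mul_le_mul_left h3 hsc) (by positivity : 0 < s ^ n)
    linarith

theorem sum_correction (α : ℝ) (n : ℕ) :
    (4 * (α + 1) ^ 2 - 1) / 16 + ∑ j ∈ Finset.range n, (α + 3 * ((j : ℝ) + 1) / 2)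
      = (2 * α + 2 * n + 1) * (2 * α + 6 * n + 3) / 16 := by
  induction n with
  | zero => simp; ring
  | succ n ih =>
    rw [Finset.sum_range_succ, ← add_assoc, ih]; push_cast; ring

/-- The constant term: (j + 1) / 2 is the limit of `scaledB α (j + 1)`. -/
theorem sum_log_half (n : ℕ) : ∑ j ∈ Finset.range n, Real.log (((j : ℝ) + 1) / 2)
    = Real.log (Real.Gamma (n + 1)) - n * Real.log 2 := by
  induction n with
  | zero => simp
  | succ n ih =>
    have h : Real.Gamma ((n : ℝ) + 1) ≠ 0 := (Real.Gamma_pos_of_pos (by positivity)).ne'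
    push_cast
    rw [Finset.sum_range_succ, ih, Real.Gamma_add_one (s := (n : ℝ) + 1) (by positivity),
      Real.log_mul (by positivity) h, Real.log_div (by positivity) two_ne_zero]
    ring

/-- An exact splitting: the explicit main part, plus logarithms of n + 1 factors normalized to tend
to 1, each contributing its own 1 / s term. -/
theorem log_normConst_eq {α : ℝ} (hα : -1 < α) (n : ℕ) {s : ℝ} (hs : 0 < s) :
    Real.log (normConst (s ^ 2) α n) =
      (-2 * s + (α + 1 / 2 + n) * Real.log s + Real.log Real.pi / 2
        + (Real.log (Real.Gamma (n + 1)) - n * Real.log 2))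
      + (Real.log (normConst (s ^ 2) α 0 / scale α s)
        + ∑ j ∈ Finset.range n, Real.log (scaledB α (j + 1) s * (2 / ((j : ℝ) + 1)))) := by
  have h0 := normConst_pos hα (sq_nonneg s) 0
  have hB : ∀ j, 0 < scaledB α (j + 1) s := fun j => div_pos (b_succ_pos hα (sq_nonneg s) j) hs
  rw [normConst_eq_prod hα n hs, Real.log_mul h0.ne'
    (mul_ne_zero (by positivity) (Finset.prod_ne_zero_iff.2 fun j _ => (hB j).ne')),
    Real.log_mul (by positivity) (Finset.prod_ne_zero_iff.2 fun j _ => (hB j).ne'),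
    Real.log_prod fun j _ => (hB j).ne', Real.log_div h0.ne' (scale_pos α hs).ne', log_scale α hs,
    Real.log_pow, ← sum_log_half]
  have e : ∀ j : ℕ, Real.log (scaledB α (j + 1) s * (2 / ((j : ℝ) + 1)))
      = Real.log (scaledB α (j + 1) s) - Real.log (((j : ℝ) + 1) / 2) := fun j => by
    rw [← Real.log_div (hB j).ne' (by positivity)]
    congr 1
    field_simp
  simp only [e, Finset.sum_sub_distrib]
  ring

theorem log_normConst_asymptotics {α : ℝ} (hα : -1 < α) (n : ℕ) :
    (fun s : ℝ => Real.log (normConst (s ^ 2) α n) -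
      ((-2 * s + (α + 1 / 2 + n) * Real.log s + Real.log Real.pi / 2
        + (Real.log (Real.Gamma (n + 1)) - n * Real.log 2))
      + (2 * α + 2 * n + 1) * (2 * α + 6 * n + 3) / 16 / s))
      =O[atTop] (fun s : ℝ => (s ^ 2)⁻¹) := by
  have h := (log_asymptotics (normConst_zero_asymptotics α)).add
    (isBigO_sum_apply fun j (_ : j ∈ Finset.range n) =>
      log_asymptotics ((stringSystem hα).c_succ_asymptotics j))
  refine h.congr' ?_ EventuallyEq.rfl
  filter_upwards [eventually_gt_atTop 0] with s hs
  rw [log_normConst_eq hα n hs, ← sum_correction, Finset.sum_sub_distrib, ← Finset.sum_div]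
  ring

end SingularLaguerre

theorem mainTheorem11 (α : ℝ) (hα : -1 < α) (n : ℕ) :
    (fun t : ℝ => Real.log (SingularLaguerre.normConst t α n) -
      (-2 * Real.sqrt t + (2 * α + 2 * (n : ℝ) + 1) / 4 * Real.log t
        + (Real.log Real.pi / 2 - (n : ℝ) * Real.log 2 + Real.log (Real.Gamma ((n : ℝ) + 1)))
        + (2 * α + 2 * (n : ℝ) + 1) * (2 * α + 6 * (n : ℝ) + 3) / (16 * Real.sqrt t)))
      =O[atTop] (fun t : ℝ => t⁻¹) := by
  have h := (SingularLaguerre.log_normConst_asymptotics hα n).comp_tendsto Real.tendsto_sqrt_atTop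
  refine h.congr' ?_ ?_
  · filter_upwards [eventually_ge_atTop 0] with t ht
    simp only [Function.comp_apply]
    rw [Real.sq_sqrt ht, Real.log_sqrt ht]
    ring
  · filter_upwards [eventually_ge_atTop 0] with t ht
    simp only [Function.comp_apply]
    rw [Real.sq_sqrt ht]
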